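/- **The algorithm.** Let $f$ be a real function, smooth near $0$, with Taylor series $x+\sum_{m\ge1}a_mx^{m\tau+1}$ at $0$, where $a_1<0$ and $\tau\ge1$ is an integer. Write $(x)_k=x(x-1)\cdots(x-k+1)$ and $$S_{k,m,s}(z)=\sum\binom{m-s}{n_1,\dots,n_k}z_1^{n_1}\cdots z_k^{n_k},$$ summed over nonnegative integers $n_1,\dots,n_k$ with $\sum_i i\,n_i=m$ and $\sum_i n_i=m-s$. Put $\lambda=-1/(\tau a_1)$ and - $b_j=\lambda^{j+1}\sum_{s=0}^{j}\frac{(-\tau)_{j+1-s}}{(j+1-s)!}S_{7,j+1,s}(a)$ for $1\le j\le 6$; - with $\beta=(1,b_1,\dots,b_6)$: $a_{0,j}=\sum_{s=0}^{j-1}\frac{(-1)^{j-1-s}}{j-s}S_{7,j,s}(\beta)$ for $1\le j\le 6$, and $a_{i,j}=\sum_{s=0}^{j-i-1}\frac{(-i)_{j-i-s}}{(j-i-s)!}S_{7,j-i,s}(\beta)$ for $1\le i<j\le 6$; - $c_0=-b_1$ and $c_i=\frac1i\bigl(b_{i+1}+\sum_{h=0}^{i-1}a_{h,i+1}c_h\bigr)$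 for $1\le i\le5$; - $T_1=X$, $T_2=b_1X-c_1$ and, for $2\le m\le5$, $$T_{m+1}=b_1\sum_{s=0}^{m-1}\tfrac{(-1)^{m-1-s}}{m-s}S_{m,m,s}(T)-c_m-\sum_{p=1}^{m-1}c_p\sum_{q=1}^{m-p}\tfrac{(-p)_q}{q!}S_{m,m-p,m-p-q}(T);$$ - $P_0=1$, $P_1=X$ and, for $2\le m\le 6$, $P_m=\sum_{s=0}^{m-1}\frac{(-1/\tau)_{m-s}}{(m-s)!}S_{6,m,s}(\widetilde T)$ with $\widetilde T_i(X)=T_i(-\tau X)$. For real $K$ let $$E_K(n)=\Bigl(\frac{\lambda}{n}\Bigr)^{1/\tau}\Bigl\{1+\sum_{m=1}^{6}P_m\Bigl(-\frac1\tau\,[\,b_1\ln n+K\,]\Bigr)\frac1{n^m}\Bigr\}.$$ **Theorem.** Let $r(x)=\frac12(-1+\sqrt{1+4x})$ and $\ell(x)=x(1-x)$, both with $\tau=1$. Superscripts $r$, $\ell$ indicate the function to which the algorithm is applied. 1. For $r$: $(a_m)_{m=1}^7=(-1,2,-5,14,-42,132,-429)$, $\lambda=1$, $(b_j)_{j=1}^6=(-1,2,-5,14,-42,132)$,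 $(a_{0,j})_{j=1}^6=(1,-\frac32,\frac{10}3,-\frac{35}4,\frac{126}5,-77)$, $(c_i)_{i=1}^5=(\frac12,-\frac13,\frac{13}{36},-\frac{113}{240},\frac{1187}{1800})$; $T_2=-X-\frac12$, $T_3=\frac12X^2+\frac32X+\frac56$, $T_4=-\frac13X^3-2X^2-\frac{19}6X-\frac{13}9$, $T_5=\frac14X^4+\frac73X^3+\frac{27}4X^2+\frac{15}2X+\frac{2009}{720}$, $T_6=-\frac15X^5-\frac{31}{12}X^4-\frac{34}3X^3-\frac{87}4X^2-\frac{3359}{180}X-\frac{6973}{1200}$; $P_2=X^2-X+\frac12$, $P_3=X^3-\frac52X^2+\frac52X-\frac56$, $P_4=X^4-\frac{13}3X^3+\frac{15}2X^2-\frac{35}6X+\frac{61}{36}$, $P_5=X^5-\frac{77}{12}X^4+\frac{101}6X^3-\frac{265}{12}X^2+\frac{515}{36}X-\frac{2609}{720}$, $P_6=X^6-\frac{87}{10}X^5+\frac{95}3X^4-61X^3+65X^2-\frac{12977}{360}X+\frac{29069}{3600}$. 2. (Formula (B).) Let $x_0>0$ and $x_n=r(x_{n-1})$ for $n\ge1$.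 There is exactly one real constant $C=C(x_0)$ with $$x_n=E^{r}_{-C}(n)+O\Bigl(\frac{(\ln n)^7}{n^8}\Bigr)\qquad(n\to\infty),$$ and for this $C$, with $L=\ln n$, $$\begin{aligned}x_n={}&\frac1n+\frac{L+C}{n^2}+\frac{L^2+(2C-1)L+(C^2-C+\frac12)}{n^3}\\&+\frac{L^3+(3C-\frac52)L^2+(3C^2-5C+\frac52)L+(C^3-\frac52C^2+\frac52C-\frac56)}{n^4}\\&+\frac1{n^5}\Bigl\{L^4+(4C-\tfrac{13}3)L^3+(6C^2-13C+\tfrac{15}2)L^2+(4C^3-13C^2+15C-\tfrac{35}6)L\\&\qquad+(C^4-\tfrac{13}3C^3+\tfrac{15}2C^2-\tfrac{35}6C+\tfrac{61}{36})\Bigr\}\\&+\frac1{n^6}\Bigl\{L^5+(5C-\tfrac{77}{12})L^4+(10C^2-\tfrac{77}3C+\tfrac{101}6)L^3+(10C^3-\tfrac{77}2C^2+\tfrac{101}2C-\tfrac{265}{12})L^2\\&\qquad+(5C^4-\tfrac{77}3C^3+\tfrac{101}2C^2-\tfrac{265}6C+\tfrac{515}{36})L\\&\qquad+(C^5-\tfrac{77}{12}C^4+\tfrac{101}6C^3-\tfrac{265}{12}C^2+\tfrac{515}{36}C-\tfrac{2609}{720})\Bigr\}+O\Bigl(\frac{L^6}{n^7}\Bigr).\end{aligned}$$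 3. (Formula (A).) Let $0<x_0<1$ and $x_n=\ell(x_{n-1})$ for $n\ge1$. There is exactly one real constant $C=C(x_0)$ with $x_n=E^{\ell}_{C}(n)+O\bigl((\ln n)^7/n^8\bigr)$ as $n\to\infty$. 4. For $1\le i\le5$, $c_i^\ell>0$ and $c_i^r=(-1)^{i+1}c_i^\ell$. For $2\le m\le6$ and $0\le j<m$, the coefficient of $X^j$ in $T^r_m$ is nonzero with sign $(-1)^{m+1}$, and it is $(-1)^{m+j}$ times the one in $T_m^\ell$. For $2\le m\le 6$ and $0\le j\le m$, the coefficient of $X^j$ in $P_m^\ell$ is positive, and the one in $P_m^r$ is $(-1)^{m+j}$ times it. 5. (Kindredness.) There are real polynomials $q_{m,j}$ ($0\le j\le m\le 6$), with $q_{m,j}$ of degree $m-j$ and with positive leading coefficient, such that for all real $C,L$ and $0\le m\le 6$ $$P^r_m\bigl(-[b_1^rL-C]\bigr)=\sum_{j=0}^m q_{m,j}(C)L^j,\qquad P^\ell_m\bigl(-[b_1^\ell L+C]\bigr)=\sum_{j=0}^m(-1)^m q_{m,j}(C)L^j.$$ That is, the term $(\ln n)^j/n^{m+1}$ has coefficient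 $+q_{m,j}(C)$ in the expansion for $r$ and $(-1)^mq_{m,j}(C)$ in the expansion for $\ell$: all signs are positive for $r$, they alternate in blocks for $\ell$, and disregarding these signs the coefficients are equal. -/

import Mathlib

open Filter Asymptotics Polynomial
open scoped Nat

namespace IterAsymp

/-- The falling factorial `x (x - 1) ⋯ (x - k + 1)`. -/
noncomputable def fall (x : ℝ) (k : ℕ) : ℝ := ∏ i ∈ Finset.range k, (x - i)

/-- The coefficient of `x ^ (m τ + 1)` in the Taylor series of `f` at the origin. -/
noncomputable def gapCoeff (f : ℝ → ℝ) (τ m : ℕ) : ℝ :=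
  iteratedDeriv (m * τ + 1) f 0 / ((m * τ + 1)! : ℝ)

/-- The sum, over all nonnegative integers `n₁, …, n_k` with `n₁ + 2 n₂ + ⋯ + k n_k = m` and
`n₁ + ⋯ + n_k = m - s`, of the multinomial coefficient of `(n₁, …, n_k)` times
`z₁ ^ n₁ ⋯ z_k ^ n_k`. The entry `n i`, with `i : Fin k`, plays the role of `n_{i+1}`. -/
noncomputable def multSum {R : Type*} [CommRing R] (k m s : ℕ) (z : ℕ → R) : R :=
  ∑ n ∈ (Finset.piAntidiag (Finset.univ : Finset (Fin k)) (m - s)).filter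
      (fun n => ∑ i : Fin k, ((i : ℕ) + 1) * n i = m),
    (Nat.multinomial Finset.univ n : R) * ∏ i : Fin k, z ((i : ℕ) + 1) ^ n i

section Algorithm

variable (τ : ℕ) (a : ℕ → ℝ)

/-- The number `λ = -1 / (τ a₁)`. -/
noncomputable def lam : ℝ := -1 / (τ * a 1)

/-- The numbers `b_j`, `1 ≤ j ≤ 6`. -/
noncomputable def b (j : ℕ) : ℝ :=
  lam τ a ^ (j + 1) * ∑ s ∈ Finset.range (j + 1),
    fall (-(τ : ℝ)) (j + 1 - s) / ((j + 1 - s)! : ℝ) * multSum 7 (j + 1) s a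

/-- The sequence `1, b₁, b₂, …`, indexed from `1`. -/
noncomputable def oneB (k : ℕ) : ℝ := if k = 1 then 1 else b τ a (k - 1)

/-- The numbers `a_{i,j}`, `0 ≤ i < j ≤ 6`. -/
noncomputable def aa (i j : ℕ) : ℝ :=
  if i = 0 then
    ∑ s ∈ Finset.range j, (-1) ^ (j - 1 - s) / ((j - s : ℕ) : ℝ) * multSum 7 j s (oneB τ a)
  else
    ∑ s ∈ Finset.range (j - i), fall (-(i : ℝ)) (j - i - s) / ((j - i - s)! : ℝ) *
      multSum 7 (j - i) s (oneB τ a)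

/-- The numbers `c_i`, `0 ≤ i ≤ 5`. -/
noncomputable def c : ℕ → ℝ
  | 0 => -b τ a 1
  | i + 1 => 1 / ((i + 1 : ℕ) : ℝ) *
      (b τ a (i + 2) + ∑ h : Fin (i + 1), aa τ a h (i + 2) * c h)
  termination_by i => i
  decreasing_by exact h.isLt

/-- The right-hand side of the recursion for `T_{m+1}`, in terms of `T₁, …, T_m`. -/
noncomputable def TStep (m : ℕ) (t : ℕ → ℝ[X]) : ℝ[X] :=
  C (b τ a 1) * ∑ s ∈ Finset.range m,
      C ((-1) ^ (m - 1 - s) / ((m - s : ℕ) : ℝ)) * multSum m m s t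
    - C (c τ a m)
    - ∑ p ∈ Finset.Icc 1 (m - 1), C (c τ a p) * ∑ q ∈ Finset.Icc 1 (m - p),
        C (fall (-(p : ℝ)) q / (q ! : ℝ)) * multSum m (m - p) (m - p - q) t

/-- The polynomials `T_m`, `1 ≤ m ≤ 6` (with the dummy value `T₀ = 0`). -/
noncomputable def T : ℕ → ℝ[X]
  | 0 => 0
  | 1 => X
  | 2 => C (b τ a 1) * X - C (c τ a 1)
  | m + 3 => TStep τ a (m + 2) (fun i => if h : i < m + 3 then T i else 0)
  termination_by m => m

/-- The polynomials `P_m`, `0 ≤ m ≤ 6`. -/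
noncomputable def P : ℕ → ℝ[X]
  | 0 => 1
  | 1 => X
  | m + 2 => ∑ s ∈ Finset.range (m + 2),
      C (fall (-(1 / (τ : ℝ))) (m + 2 - s) / ((m + 2 - s)! : ℝ)) *
        multSum 6 (m + 2) s (fun i => (T τ a i).comp (-(C (τ : ℝ) * X)))

/-- The right-hand side
`(λ / n) ^ (1 / τ) * (1 + ∑_{m = 1}^{6} P_m (-(1 / τ) (b₁ log n + K)) / n ^ m)`. -/
noncomputable def expansion (K : ℝ) (n : ℕ) : ℝ :=
  (lam τ a / n) ^ (1 / (τ : ℝ)) *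
    (1 + ∑ m ∈ Finset.Icc 1 6,
      (P τ a m).eval (-(1 / (τ : ℝ)) * (b τ a 1 * Real.log n + K)) * (1 / (n : ℝ) ^ m))

end Algorithm

/-- The logistic function. -/
noncomputable def logistic (x : ℝ) : ℝ := x * (1 - x)

/-- The radical function. -/
noncomputable def radical (x : ℝ) : ℝ := 1 / 2 * (-1 + Real.sqrt (1 + 4 * x))

/-- Taylor coefficients `a_m` of the logistic function (`τ = 1`). -/
noncomputable def aLog : ℕ → ℝ := gapCoeff logistic 1

/-- Taylor coefficients `a_m` of the radical function (`τ = 1`). -/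
noncomputable def aRad : ℕ → ℝ := gapCoeff radical 1

/-- The explicit expansion with 21 terms, up to order `1 / n ^ 6`, where `L = log n`. -/
noncomputable def display (K L n : ℝ) : ℝ :=
  1 / n
  + L / n ^ 2 + K / n ^ 2
  + L ^ 2 / n ^ 3 + (2 * K - 1) * L / n ^ 3 + (K ^ 2 - K + 1 / 2) * (1 / n ^ 3)
  + L ^ 3 / n ^ 4 + (3 * K - 5 / 2) * L ^ 2 / n ^ 4
  + (3 * K ^ 2 - 5 * K + 5 / 2) * L / n ^ 4
  + (K ^ 3 - 5 / 2 * K ^ 2 + 5 / 2 * K - 5 / 6) * (1 / n ^ 4)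
  + L ^ 4 / n ^ 5 + (4 * K - 13 / 3) * L ^ 3 / n ^ 5
  + (6 * K ^ 2 - 13 * K + 15 / 2) * L ^ 2 / n ^ 5
  + (4 * K ^ 3 - 13 * K ^ 2 + 15 * K - 35 / 6) * L / n ^ 5
  + (K ^ 4 - 13 / 3 * K ^ 3 + 15 / 2 * K ^ 2 - 35 / 6 * K + 61 / 36) * (1 / n ^ 5)
  + L ^ 5 / n ^ 6 + (5 * K - 77 / 12) * L ^ 4 / n ^ 6
  + (10 * K ^ 2 - 77 / 3 * K + 101 / 6) * L ^ 3 / n ^ 6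
  + (10 * K ^ 3 - 77 / 2 * K ^ 2 + 101 / 2 * K - 265 / 12) * L ^ 2 / n ^ 6
  + (5 * K ^ 4 - 77 / 3 * K ^ 3 + 101 / 2 * K ^ 2 - 265 / 6 * K + 515 / 36) * L / n ^ 6
  + (K ^ 5 - 77 / 12 * K ^ 4 + 101 / 6 * K ^ 3 - 265 / 12 * K ^ 2 + 515 / 36 * K
      - 2609 / 720) * (1 / n ^ 6)

end IterAsymp

namespace IterAsymp

/-! The two functions come from one map, `g z = z * (1 + z)`. The radical function is a right
inverse of `g` on the positive axis, and `z = -x` conjugates the logistic function to `g`. So `z n =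
x n` (radical) satisfies `g (z (n + 1)) = z n`, while `z n = -x n` (logistic) satisfies `z (n + 1) =
g (z n)`. A sign `ε`, equal to `1` for the radical and `-1` for the logistic function, treats both
cases at once.

The numbers `c_i` of the radical function are the coefficients of an approximate Abel function:
`abel z = 1 / z - log z + ∑ c_i z ^ i` drops by `1 + O(z ^ 7)` under `g`
(`abel_sub_abel_comp_sub_one`). Along an orbit `z n = O(1 / n)`, so these errors are summable and
`abel (z n) = ε n - K + O(n ^ (-6))` for some constant `K` (`exists_limit_of_abs_sub_le`). The
polynomials `P_m` invert `abel`: with `s = 1 / (ε n)` and `q = log n + K`, the truncated expansion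
has Abel value `ε n - K + O((log n) ^ 7 / n ^ 6)` (`abel_truncExp`).

Near the origin, on either side, `abel` varies like `1 / z`, so a difference of Abel values is
comparable with `(z - z') / (z z')` (`abel_sub_abel_bounds`). With `z` and `z'` of order `1 / n`
this gains a factor `n ^ (-2)`, hence the error `(log n) ^ 7 / n ^ 8`. Read backwards, the same
comparison shows that two admissible constants differ by a quantity tending to zero.

The explicit data reduce to power series arithmetic: the multinomial sums are coefficients of powers
of a series, and for `τ = 1` the sums defining `b_j` and `P_m` are coefficients of a reciprocal.
Kindredness is the parity relation `P_m^ℓ(-x) = (-1) ^ m P_m^r(x)` combined with the Taylor formula.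
-/

/-! ### Multinomial sums as coefficients of powers of a series -/

/-- The coefficient of `t ^ m` in `(z₁ t + z₂ t ^ 2 + ⋯) ^ N`. -/
def powCoeff {R : Type*} [CommRing R] (z : ℕ → R) : ℕ → ℕ → R
  | 0, m => if m = 0 then 1 else 0
  | N + 1, m => ∑ i ∈ Finset.range m, z (i + 1) * powCoeff z N (m - (i + 1))

theorem coeff_sum_pow_eq_powCoeff {R : Type*} [CommRing R] (z : ℕ → R) (k N : ℕ) :
    ∀ m ≤ k, ((∑ i : Fin k, C (z ((i : ℕ) + 1)) * (X : R[X]) ^ ((i : ℕ) + 1)) ^ N).coeff m =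
      powCoeff z N m := by
  induction N with
  | zero => intro m _; simp [powCoeff, coeff_one]
  | succ N ih =>
    intro m hm
    rw [pow_succ', Finset.sum_mul, finsetSum_coeff, powCoeff,
      Fin.sum_univ_eq_sum_range (fun i => (C (z (i + 1)) * (X : R[X]) ^ (i + 1) *
        (∑ i : Fin k, C (z ((i : ℕ) + 1)) * (X : R[X]) ^ ((i : ℕ) + 1)) ^ N).coeff m) k]
    symm
    refine Finset.sum_subset_zero_on_sdiff (Finset.range_mono hm) ?_ ?_
    · intro i hi
      simp only [Finset.mem_sdiff, Finset.mem_range, not_lt] at hi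
      rw [mul_assoc, coeff_C_mul, coeff_X_pow_mul', if_neg (by omega), mul_zero]
    · intro i hi
      rw [Finset.mem_range] at hi
      rw [mul_assoc, coeff_C_mul, coeff_X_pow_mul', if_pos (by omega), ih _ (by omega)]

/-- By the multinomial theorem, the constraint on `∑ (i + 1) * n i` selects the coefficient of `t ^
m` in the power of exponent `m - s`. Since `m ≤ k`, truncating the series after `z k` loses nothing.
-/
theorem multSum_eq_powCoeff {R : Type*} [CommRing R] (z : ℕ → R) {k m : ℕ} (hm : m ≤ k) (s : ℕ) :
    multSum k m s z = powCoeff z (m - s) m := by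
  rw [← coeff_sum_pow_eq_powCoeff z k _ m hm, Finset.sum_pow_eq_sum_piAntidiag, finsetSum_coeff,
    multSum, Finset.sum_filter]
  refine Finset.sum_congr rfl fun n _ => ?_
  have h : ∏ i : Fin k, (C (z ((i : ℕ) + 1)) * (X : R[X]) ^ ((i : ℕ) + 1)) ^ n i =
      C (∏ i : Fin k, z ((i : ℕ) + 1) ^ n i) * X ^ (∑ i : Fin k, ((i : ℕ) + 1) * n i) := by
    simp only [mul_pow, ← pow_mul, Finset.prod_mul_distrib, Finset.prod_pow_eq_pow_sum, map_prod,
      map_pow]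
  rw [h, ← C_eq_natCast, coeff_C_mul, coeff_C_mul, coeff_X_pow]
  split_ifs with h1 h2 h2
  · rw [mul_one]
  · exact absurd h1.symm h2
  · exact absurd h2.symm h1
  · simp

theorem map_powCoeff {R S : Type*} [CommRing R] [CommRing S] (f : R →+* S) (z : ℕ → R) (N : ℕ) :
    ∀ m, f (powCoeff z N m) = powCoeff (fun i => f (z i)) N m := by
  induction N with
  | zero => intro m; simp only [powCoeff]; split_ifs <;> simp
  | succ N ih => intro m; simp [powCoeff, map_sum, ih]

theorem fall_succ (x : ℝ) (k : ℕ) : fall x (k + 1) = fall x k * (x - k) := by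
  simp [fall, Finset.prod_range_succ]

/-- The binomial coefficient of `-1` over `k`. For `τ = 1` it turns the sums of the algorithm into
geometric series, that is, into reciprocals. -/
theorem fall_neg_one_div_factorial (k : ℕ) : fall (-1) k / (k ! : ℝ) = (-1) ^ k := by
  rw [div_eq_iff (by positivity)]
  induction k with
  | zero => simp [fall]
  | succ k ih => rw [fall_succ, ih, Nat.factorial_succ]; push_cast; ring

/-! ### Taylor coefficients -/

theorem aLog_eq (m : ℕ) (hm : 1 ≤ m) : aLog m = if m = 1 then -1 else 0 := by
  have h1 : iteratedDeriv 1 logistic = fun x => 1 - 2 * x := by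
    rw [iteratedDeriv_one]
    funext x
    have : HasDerivAt logistic (1 * (1 - x) + x * (0 - 1)) x :=
      (hasDerivAt_id x).mul ((hasDerivAt_const x 1).sub (hasDerivAt_id x))
    rw [this.deriv]; ring
  have h2 : iteratedDeriv 2 logistic = fun _ => -2 := by
    rw [iteratedDeriv_succ, h1]
    funext x
    have : HasDerivAt (fun x : ℝ => 1 - 2 * x) (0 - 2 * 1) x :=
      (hasDerivAt_const x 1).sub ((hasDerivAt_id x).const_mul 2)
    rw [this.deriv]; ring
  have h3 : ∀ k, iteratedDeriv (k + 3) logistic = fun _ => 0 := by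
    intro k
    induction k with
    | zero => rw [iteratedDeriv_succ, h2]; funext x; simp
    | succ k ih => rw [iteratedDeriv_succ, ih]; funext x; simp
  obtain ⟨k, rfl⟩ := Nat.exists_eq_add_of_le' hm
  rcases k with _ | k
  · simp [aLog, gapCoeff, h2]
  · simp [aLog, gapCoeff, h3]

theorem iteratedDeriv_radical (k : ℕ) : ∀ x : ℝ, -1 / 4 < x →
    iteratedDeriv (k + 1) radical x =
      (-4) ^ k * (∏ i ∈ Finset.range k, ((i : ℝ) + 1 / 2)) * (1 + 4 * x) ^ (-(1 / 2 : ℝ) - k) := by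
  have hd : ∀ x : ℝ, HasDerivAt (fun x : ℝ => 1 + 4 * x) 4 x := fun x => by
    simpa using ((hasDerivAt_id x).const_mul 4).const_add 1
  induction k with
  | zero =>
    intro x hx
    have h0 : 0 < 1 + 4 * x := by linarith
    rw [zero_add, iteratedDeriv_one]
    have h : HasDerivAt radical (1 / 2 * (4 / (2 * Real.sqrt (1 + 4 * x)))) x :=
      (((hd x).sqrt h0.ne').const_add (-1)).const_mul (1 / 2)
    rw [h.deriv]
    simp only [pow_zero, Finset.range_zero, Finset.prod_empty, Nat.cast_zero, sub_zero, one_mul]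
    rw [Real.rpow_neg h0.le, ← Real.sqrt_eq_rpow]
    have := Real.sqrt_pos.2 h0
    field_simp
    norm_num
  | succ k ih =>
    intro x hx
    have h0 : 0 < 1 + 4 * x := by linarith
    rw [iteratedDeriv_succ]
    -- Differentiating once more needs the formula on a whole neighbourhood of `x`, which the open
    -- condition `-1 / 4 < x` provides.
    have he : iteratedDeriv (k + 1) radical =ᶠ[nhds x] fun x =>
        (-4) ^ k * (∏ i ∈ Finset.range k, ((i : ℝ) + 1 / 2)) *
          (1 + 4 * x) ^ (-(1 / 2 : ℝ) - k) := by
      filter_upwards [lt_mem_nhds hx] with y hy using ih y hy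
    rw [he.deriv_eq]
    have h := ((hd x).rpow_const (p := -(1 / 2 : ℝ) - k) (Or.inl h0.ne')).const_mul
      ((-4) ^ k * (∏ i ∈ Finset.range k, ((i : ℝ) + 1 / 2)))
    rw [h.deriv, Finset.prod_range_succ, pow_succ]
    rw [show -(1 / 2 : ℝ) - (k + 1 : ℕ) = -(1 / 2 : ℝ) - k - 1 by push_cast; ring]
    ring

theorem aRad_eq (m : ℕ) :
    aRad m = (-4) ^ m * (∏ i ∈ Finset.range m, ((i : ℝ) + 1 / 2)) / ((m + 1)! : ℝ) := by
  rw [aRad, gapCoeff, mul_one, iteratedDeriv_radical m 0 (by norm_num)]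
  norm_num

/-! ### Reciprocal series and the numbers `b_j` -/

theorem powCoeff_congr {R : Type*} [CommRing R] {z z' : ℕ → R} (N : ℕ) :
    ∀ {m : ℕ}, (∀ i, 1 ≤ i → i ≤ m → z i = z' i) → powCoeff z N m = powCoeff z' N m := by
  induction N with
  | zero => intro m _; rfl
  | succ N ih =>
    intro m h
    refine Finset.sum_congr rfl fun i hi => ?_
    rw [Finset.mem_range] at hi
    rw [h _ (by omega) (by omega), ih fun l hl hl' => h l hl (by omega)]

theorem powCoeff_eq_zero_of_lt {R : Type*} [CommRing R] (z : ℕ → R) (N : ℕ) :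
    ∀ {m : ℕ}, m < N → powCoeff z N m = 0 := by
  induction N with
  | zero => intro m h; omega
  | succ N ih =>
    intro m h
    refine Finset.sum_eq_zero fun i hi => ?_
    rw [Finset.mem_range] at hi
    rw [ih (by omega), mul_zero]

/-- The coefficient of `t ^ m` in `1 / (1 + z₁ t + z₂ t ^ 2 + ⋯)`. -/
def invCoeff {R : Type*} [CommRing R] (z : ℕ → R) (m : ℕ) : R :=
  ∑ k ∈ Finset.range (m + 1), (-1) ^ k * powCoeff z k m

theorem invCoeff_zero {R : Type*} [CommRing R] (z : ℕ → R) : invCoeff z 0 = 1 := by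
  simp [invCoeff, powCoeff]

/-- The convolution recursion for a reciprocal, obtained by splitting one factor off each power. It
makes the later numerical evaluations short. -/
theorem invCoeff_succ {R : Type*} [CommRing R] (z : ℕ → R) (m : ℕ) :
    invCoeff z (m + 1) = -∑ i ∈ Finset.range (m + 1), z (i + 1) * invCoeff z (m - i) := by
  rw [invCoeff, Finset.sum_range_succ']
  simp only [powCoeff, Nat.add_eq_zero_iff, one_ne_zero, and_false, if_false, mul_zero, add_zero,
    Finset.mul_sum]
  rw [Finset.sum_comm, ← Finset.sum_neg_distrib]
  refine Finset.sum_congr rfl fun i hi => ?_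
  rw [Finset.mem_range] at hi
  rw [invCoeff, Finset.mul_sum, ← Finset.sum_neg_distrib]
  symm
  refine Finset.sum_subset_zero_on_sdiff (Finset.range_mono (by omega)) ?_ ?_
  · intro k hk
    simp only [Finset.mem_sdiff, Finset.mem_range, not_lt] at hk
    rw [Nat.add_sub_add_right, powCoeff_eq_zero_of_lt z k (by omega), mul_zero, mul_zero]
  · intro k _
    rw [Nat.add_sub_add_right, pow_succ]
    ring

theorem sum_powCoeff_eq_invCoeff {R : Type*} [CommRing R] (z : ℕ → R) {m : ℕ} (hm : 1 ≤ m) :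
    ∑ s ∈ Finset.range m, (-1) ^ (m - s) * powCoeff z (m - s) m = invCoeff z m := by
  rw [invCoeff, Finset.sum_range_succ', powCoeff, if_neg (by omega), mul_zero, add_zero,
    ← Finset.sum_range_reflect]
  refine Finset.sum_congr rfl fun s hs => ?_
  rw [Finset.mem_range] at hs
  rw [show m - (m - 1 - s) = s + 1 by omega]

theorem aRad_values : aRad 1 = -1 ∧ aRad 2 = 2 ∧ aRad 3 = -5 ∧ aRad 4 = 14 ∧ aRad 5 = -42 ∧
    aRad 6 = 132 ∧ aRad 7 = -429 := by
  simp only [aRad_eq]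
  refine ⟨?_, ?_, ?_, ?_, ?_, ?_, ?_⟩ <;>
  norm_num [Finset.prod_range_succ, Nat.factorial]

theorem aLog_values : aLog 1 = -1 ∧ aLog 2 = 0 ∧ aLog 3 = 0 ∧ aLog 4 = 0 ∧ aLog 5 = 0 ∧
    aLog 6 = 0 ∧ aLog 7 = 0 := by
  refine ⟨?_, ?_, ?_, ?_, ?_, ?_, ?_⟩ <;> rw [aLog_eq _ (by norm_num)] <;> norm_num

theorem lam_rad : lam 1 aRad = 1 := by simp [lam, aRad_values]

theorem lam_log : lam 1 aLog = 1 := by simp [lam, aLog_values]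

theorem b_eq_invCoeff (a : ℕ → ℝ) {j : ℕ} (hj : j ≤ 6) :
    b 1 a j = lam 1 a ^ (j + 1) * invCoeff a (j + 1) := by
  simp only [b, Nat.cast_one, fall_neg_one_div_factorial,
    multSum_eq_powCoeff a (show j + 1 ≤ 7 by omega)]
  rw [sum_powCoeff_eq_invCoeff _ (by omega)]

theorem b_rad_values : b 1 aRad 1 = -1 ∧ b 1 aRad 2 = 2 ∧ b 1 aRad 3 = -5 ∧ b 1 aRad 4 = 14 ∧
    b 1 aRad 5 = -42 ∧ b 1 aRad 6 = 132 := by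
  obtain ⟨h1, h2, h3, h4, h5, h6, h7⟩ := aRad_values
  refine ⟨?_, ?_, ?_, ?_, ?_, ?_⟩ <;> rw [b_eq_invCoeff _ (by norm_num), lam_rad] <;>
  norm_num [invCoeff_succ, invCoeff_zero, Finset.sum_range_succ, h1, h2, h3, h4, h5, h6, h7]

theorem b_log_values : b 1 aLog 1 = 1 ∧ b 1 aLog 2 = 1 ∧ b 1 aLog 3 = 1 ∧ b 1 aLog 4 = 1 ∧
    b 1 aLog 5 = 1 ∧ b 1 aLog 6 = 1 := by
  obtain ⟨h1, h2, h3, h4, h5, h6, h7⟩ := aLog_values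
  refine ⟨?_, ?_, ?_, ?_, ?_, ?_⟩ <;> rw [b_eq_invCoeff _ (by norm_num), lam_log] <;>
  norm_num [invCoeff_succ, invCoeff_zero, Finset.sum_range_succ, h1, h2, h3, h4, h5, h6, h7]

/-! ### Exact evaluation of the numbers `a_{i,j}` and `c_i` -/

/-- Rational counterpart of `aa`, as a function of the sequence `1, b₁, b₂, …`. -/
def aaRat (z : ℕ → ℚ) (i j : ℕ) : ℚ :=
  if i = 0 then
    ∑ s ∈ Finset.range j, (-1) ^ (j - 1 - s) / ((j - s : ℕ) : ℚ) * powCoeff z (j - s) j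
  else
    ∑ s ∈ Finset.range (j - i), (∏ l ∈ Finset.range (j - i - s), (-(i : ℚ) - l)) /
      ((j - i - s)! : ℚ) * powCoeff z (j - i - s) (j - i)

/-- Transfers the computation to `ℚ`, where equalities are decidable and the kernel can evaluate
them. -/
theorem aa_eq_aaRat (a : ℕ → ℝ) (z : ℕ → ℚ) (hz : ∀ i, 1 ≤ i → i ≤ 7 → oneB 1 a i = z i)
    {i j : ℕ} (hj : j ≤ 7) : aa 1 a i j = aaRat z i j := by
  have h : ∀ N m, m ≤ 7 → powCoeff (oneB 1 a) N m = ((powCoeff z N m : ℚ) : ℝ) := by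
    intro N m hm
    have := map_powCoeff (Rat.castHom ℝ) z N m
    rw [Rat.coe_castHom] at this
    rw [this]
    exact powCoeff_congr N fun i hi hi' => hz i hi (by omega)
  by_cases hi : i = 0
  · rw [aa, aaRat, if_pos hi, if_pos hi]
    push_cast
    refine Finset.sum_congr rfl fun s _ => ?_
    rw [multSum_eq_powCoeff _ hj, h _ _ hj]
  · rw [aa, aaRat, if_neg hi, if_neg hi]
    push_cast
    refine Finset.sum_congr rfl fun s _ => ?_
    rw [multSum_eq_powCoeff _ (by omega), h _ _ (by omega), fall]

/-- The sequence `1, b₁, …, b₆` for the radical function. -/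
def oneBRad (i : ℕ) : ℚ := [0, 1, -1, 2, -5, 14, -42, 132].getD i 0

theorem oneB_rad (i : ℕ) (h : 1 ≤ i) (h' : i ≤ 7) : oneB 1 aRad i = oneBRad i := by
  obtain ⟨h1, h2, h3, h4, h5, h6⟩ := b_rad_values
  interval_cases i <;> simp [oneB, oneBRad, *]

theorem oneB_log (i : ℕ) (h : 1 ≤ i) (h' : i ≤ 7) : oneB 1 aLog i = ((1 : ℚ) : ℝ) := by
  obtain ⟨h1, h2, h3, h4, h5, h6⟩ := b_log_values
  interval_cases i <;> simp [oneB, *]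

theorem c_zero (a : ℕ → ℝ) : c 1 a 0 = -b 1 a 1 := by rw [c]

theorem c_succ (a : ℕ → ℝ) (i : ℕ) : c 1 a (i + 1) = 1 / ((i + 1 : ℕ) : ℝ) *
    (b 1 a (i + 2) + ∑ h ∈ Finset.range (i + 1), aa 1 a h (i + 2) * c 1 a h) := by
  rw [c, Fin.sum_univ_eq_sum_range (fun h => aa 1 a h (i + 2) * c 1 a h)]

theorem aa_rad {i j : ℕ} (hj : j ≤ 7) : aa 1 aRad i j = aaRat oneBRad i j :=
  aa_eq_aaRat _ _ oneB_rad hj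

theorem aa_rad_values (j : Fin 6) : aa 1 aRad 0 (j + 1) =
    ![1, -3 / 2, 10 / 3, -35 / 4, 126 / 5, -77] j := by
  rw [aa_rad (by omega)]
  have h : ∀ j : Fin 6, aaRat oneBRad 0 (j + 1) =
    (![1, -3 / 2, 10 / 3, -35 / 4, 126 / 5, -77] : Fin 6 → ℚ) j := by decide +kernel
  rw [h]
  fin_cases j <;> simp

/-- The recursion determines the `c_i`, so a guessed rational sequence `γ` is correct once it
satisfies the recursion over `ℚ`. The shift is `z (i + 1) = b_i`. -/
theorem c_eq_of_recursion (a : ℕ → ℝ) (z γ : ℕ → ℚ)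
    (hz : ∀ i, 1 ≤ i → i ≤ 7 → oneB 1 a i = z i) (h0 : γ 0 = -z 2)
    (hγ : ∀ i : Fin 5, γ (i + 1) = 1 / ((i + 1 : ℕ) : ℚ) *
      (z (i + 3) + ∑ h ∈ Finset.range (i + 1), aaRat z h (i + 2) * γ h)) (i : ℕ) (hi : i ≤ 5) :
    c 1 a i = γ i := by
  have hb : ∀ i, 1 ≤ i → i ≤ 6 → b 1 a i = z (i + 1) := fun i h h' => by
    rw [← hz (i + 1) (by omega) (by omega), oneB, if_neg (by omega), Nat.add_sub_cancel]
  induction i using Nat.strong_induction_on with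
  | _ i ih =>
    rcases i with _ | i
    · rw [c_zero, hb 1 le_rfl (by norm_num), h0]; push_cast; ring
    · rw [c_succ, hγ ⟨i, by omega⟩, hb (i + 2) (by omega) (by omega)]
      push_cast
      congr 2
      refine Finset.sum_congr rfl fun h hh => ?_
      rw [Finset.mem_range] at hh
      rw [ih h (by omega) (by omega), aa_eq_aaRat a z hz (by omega)]

/-- The numbers `c₀, …, c₅` for the radical function. -/
def cRad (i : ℕ) : ℚ := [1, 1 / 2, -1 / 3, 13 / 36, -113 / 240, 1187 / 1800].getD i 0

/-- The numbers `c₀, …, c₅` for the logistic function. -/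
def cLog (i : ℕ) : ℚ := [-1, 1 / 2, 1 / 3, 13 / 36, 113 / 240, 1187 / 1800].getD i 0

theorem c_rad (i : ℕ) (hi : i ≤ 5) : c 1 aRad i = cRad i :=
  c_eq_of_recursion aRad oneBRad cRad oneB_rad (by decide +kernel) (by decide +kernel) i hi

theorem c_log (i : ℕ) (hi : i ≤ 5) : c 1 aLog i = cLog i :=
  c_eq_of_recursion aLog (fun _ => 1) cLog oneB_log (by decide +kernel) (by decide +kernel) i hi

theorem c_rad_values : c 1 aRad 1 = 1 / 2 ∧ c 1 aRad 2 = -1 / 3 ∧ c 1 aRad 3 = 13 / 36 ∧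
    c 1 aRad 4 = -113 / 240 ∧ c 1 aRad 5 = 1187 / 1800 := by
  refine ⟨?_, ?_, ?_, ?_, ?_⟩ <;> rw [c_rad _ (by norm_num)] <;> norm_num [cRad]

theorem c_log_values : c 1 aLog 1 = 1 / 2 ∧ c 1 aLog 2 = 1 / 3 ∧ c 1 aLog 3 = 13 / 36 ∧
    c 1 aLog 4 = 113 / 240 ∧ c 1 aLog 5 = 1187 / 1800 := by
  refine ⟨?_, ?_, ?_, ?_, ?_⟩ <;> rw [c_log _ (by norm_num)] <;> norm_num [cLog]

/-! ### The polynomials `T` and `P` -/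

theorem eval_multSum (z : ℕ → ℝ[X]) {k m : ℕ} (hm : m ≤ k) (s : ℕ) (x : ℝ) :
    (multSum k m s z).eval x = powCoeff (fun i => (z i).eval x) (m - s) m := by
  rw [multSum_eq_powCoeff _ hm, ← coe_evalRingHom, map_powCoeff]

theorem eval_T (a : ℕ → ℝ) (m : ℕ) (x : ℝ) : (T 1 a (m + 3)).eval x =
    b 1 a 1 * ∑ s ∈ Finset.range (m + 2), (-1) ^ (m + 1 - s) / ((m + 2 - s : ℕ) : ℝ) *
      powCoeff (fun i => (T 1 a i).eval x) (m + 2 - s) (m + 2)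
    - c 1 a (m + 2)
    - ∑ p ∈ Finset.Icc 1 (m + 1), c 1 a p * ∑ q ∈ Finset.Icc 1 (m + 2 - p),
      fall (-(p : ℝ)) q / (q ! : ℝ) *
        powCoeff (fun i => (T 1 a i).eval x) q (m + 2 - p) := by
  have h : ∀ N k, k ≤ m + 2 →
      powCoeff (fun i => (if h : i < m + 3 then T 1 a i else 0 : ℝ[X]).eval x) N k =
        powCoeff (fun i => (T 1 a i).eval x) N k := fun N k hk =>
    -- A coefficient of index at most `m + 2` involves no `T_i` with larger `i`, so the dummy branch
    -- is never reached.
    powCoeff_congr N fun i _ hi => by rw [dif_pos (by omega)]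
  rw [T, TStep]
  simp only [eval_sub, eval_mul, eval_C, eval_finsetSum]
  congr 1
  · congr 2
    refine Finset.sum_congr rfl fun s _ => ?_
    rw [eval_multSum _ le_rfl, h _ _ le_rfl, show m + 2 - 1 - s = m + 1 - s by omega]
  · refine Finset.sum_congr rfl fun p hp => ?_
    congr 1
    refine Finset.sum_congr rfl fun q hq => ?_
    rw [Finset.mem_Icc] at hp hq
    rw [eval_multSum _ (by omega), h _ _ (by omega), show m + 2 - p - (m + 2 - p - q) = q by omega]

theorem T_one (a : ℕ → ℝ) : T 1 a 1 = X := by rw [T]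

theorem T_two (a : ℕ → ℝ) : T 1 a 2 = C (b 1 a 1) * X - C (c 1 a 1) := by rw [T]

/-- The `P_m` are the coefficients of the reciprocal of `1 + ∑ T_i(-X) t ^ i`; evaluating at a point
turns this into a statement about real sequences. -/
theorem eval_P (a : ℕ → ℝ) {m : ℕ} (hm : m + 2 ≤ 6) (x : ℝ) : (P 1 a (m + 2)).eval x =
    invCoeff (fun i => (T 1 a i).eval (-x)) (m + 2) := by
  rw [P, ← sum_powCoeff_eq_invCoeff _ (by omega), eval_finsetSum]
  refine Finset.sum_congr rfl fun s _ => ?_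
  rw [eval_mul, eval_C, eval_multSum _ hm, Nat.cast_one, div_one, fall_neg_one_div_factorial]
  simp

set_option maxHeartbeats 1000000 in
theorem T_rad_values :
    T 1 aRad 2 = -X - C (1 / 2) ∧
    T 1 aRad 3 = C (1 / 2) * X ^ 2 + C (3 / 2) * X + C (5 / 6) ∧
    T 1 aRad 4 =
      -C (1 / 3) * X ^ 3 - C 2 * X ^ 2 - C (19 / 6) * X - C (13 / 9) ∧
    T 1 aRad 5 =
      C (1 / 4) * X ^ 4 + C (7 / 3) * X ^ 3 + C (27 / 4) * X ^ 2 + C (15 / 2) * X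
        + C (2009 / 720) ∧
    T 1 aRad 6 =
      -C (1 / 5) * X ^ 5 - C (31 / 12) * X ^ 4 - C (34 / 3) * X ^ 3 - C (87 / 4) * X ^ 2
        - C (3359 / 180) * X - C (6973 / 1200) := by
  obtain ⟨h1, h2, h3, h4, h5⟩ := c_rad_values
  have hb := b_rad_values.1
  have t1 := T_one aRad
  have t2 : T 1 aRad 2 = -X - C (1 / 2) := by
    rw [T_two, hb, h1]; simp
  have t3 : T 1 aRad 3 = C (1 / 2) * X ^ 2 + C (3 / 2) * X + C (5 / 6) := by
    refine Polynomial.funext fun x => ?_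
    rw [eval_T]
    simp [Finset.sum_range_succ, powCoeff, fall,
      Nat.factorial, *]
    ring
  have t4 : T 1 aRad 4 =
      -C (1 / 3) * X ^ 3 - C 2 * X ^ 2 - C (19 / 6) * X - C (13 / 9) := by
    refine Polynomial.funext fun x => ?_
    rw [eval_T]
    simp [Finset.sum_range_succ, Finset.sum_Icc_succ_top, powCoeff, fall, Finset.prod_range_succ,
      Nat.factorial, *]
    ring
  have t5 : T 1 aRad 5 =
      C (1 / 4) * X ^ 4 + C (7 / 3) * X ^ 3 + C (27 / 4) * X ^ 2 + C (15 / 2) * X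
        + C (2009 / 720) := by
    refine Polynomial.funext fun x => ?_
    rw [eval_T]
    simp [Finset.sum_range_succ, Finset.sum_Icc_succ_top, powCoeff, fall, Finset.prod_range_succ,
      Nat.factorial, *]
    ring
  refine ⟨t2, t3, t4, t5, Polynomial.funext fun x => ?_⟩
  rw [eval_T]
  simp [Finset.sum_range_succ, Finset.sum_Icc_succ_top, powCoeff, fall, Finset.prod_range_succ,
    Nat.factorial, *]
  ring

set_option maxHeartbeats 1000000 in
theorem T_log_values :
    T 1 aLog 2 = X - C (1 / 2) ∧
    T 1 aLog 3 = -C (1 / 2) * X ^ 2 + C (3 / 2) * X - C (5 / 6) ∧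
    T 1 aLog 4 =
      C (1 / 3) * X ^ 3 - C 2 * X ^ 2 + C (19 / 6) * X - C (13 / 9) ∧
    T 1 aLog 5 =
      -C (1 / 4) * X ^ 4 + C (7 / 3) * X ^ 3 - C (27 / 4) * X ^ 2 + C (15 / 2) * X
        - C (2009 / 720) ∧
    T 1 aLog 6 =
      C (1 / 5) * X ^ 5 - C (31 / 12) * X ^ 4 + C (34 / 3) * X ^ 3 - C (87 / 4) * X ^ 2
        + C (3359 / 180) * X - C (6973 / 1200) := by
  obtain ⟨h1, h2, h3, h4, h5⟩ := c_log_values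
  have hb := b_log_values.1
  have t1 := T_one aLog
  have t2 : T 1 aLog 2 = X - C (1 / 2) := by
    rw [T_two, hb, h1]; simp
  have t3 : T 1 aLog 3 = -C (1 / 2) * X ^ 2 + C (3 / 2) * X - C (5 / 6) := by
    refine Polynomial.funext fun x => ?_
    rw [eval_T]
    simp [Finset.sum_range_succ, powCoeff, fall,
      Nat.factorial, *]
    ring
  have t4 : T 1 aLog 4 =
      C (1 / 3) * X ^ 3 - C 2 * X ^ 2 + C (19 / 6) * X - C (13 / 9) := by
    refine Polynomial.funext fun x => ?_
    rw [eval_T]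
    simp [Finset.sum_range_succ, Finset.sum_Icc_succ_top, powCoeff, fall, Finset.prod_range_succ,
      Nat.factorial, *]
    ring
  have t5 : T 1 aLog 5 =
      -C (1 / 4) * X ^ 4 + C (7 / 3) * X ^ 3 - C (27 / 4) * X ^ 2 + C (15 / 2) * X
        - C (2009 / 720) := by
    refine Polynomial.funext fun x => ?_
    rw [eval_T]
    simp [Finset.sum_range_succ, Finset.sum_Icc_succ_top, powCoeff, fall, Finset.prod_range_succ,
      Nat.factorial, *]
    ring
  refine ⟨t2, t3, t4, t5, Polynomial.funext fun x => ?_⟩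
  rw [eval_T]
  simp [Finset.sum_range_succ, Finset.sum_Icc_succ_top, powCoeff, fall, Finset.prod_range_succ,
    Nat.factorial, *]
  ring

theorem P_rad_values :
    P 1 aRad 2 = X ^ 2 - X + C (1 / 2) ∧
    P 1 aRad 3 =
      X ^ 3 - C (5 / 2) * X ^ 2 + C (5 / 2) * X - C (5 / 6) ∧
    P 1 aRad 4 =
      X ^ 4 - C (13 / 3) * X ^ 3 + C (15 / 2) * X ^ 2 - C (35 / 6) * X
        + C (61 / 36) ∧
    P 1 aRad 5 =
      X ^ 5 - C (77 / 12) * X ^ 4 + C (101 / 6) * X ^ 3 - C (265 / 12) * X ^ 2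
        + C (515 / 36) * X - C (2609 / 720) ∧
    P 1 aRad 6 =
      X ^ 6 - C (87 / 10) * X ^ 5 + C (95 / 3) * X ^ 4 - C 61 * X ^ 3
        + C 65 * X ^ 2 - C (12977 / 360) * X + C (29069 / 3600) := by
  have t1 := T_one aRad
  obtain ⟨t2, t3, t4, t5, t6⟩ := T_rad_values
  refine ⟨?_, ?_, ?_, ?_, ?_⟩ <;> refine Polynomial.funext fun x => ?_ <;>
    rw [eval_P _ (by norm_num)] <;>
    simp [invCoeff_succ, invCoeff_zero, Finset.sum_range_succ, *] <;> ring

theorem P_rad_one : P 1 aRad 1 = X := by rw [P]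

theorem P_rad_zero : P 1 aRad 0 = 1 := by rw [P]

theorem P_log_values :
    P 1 aLog 2 = X ^ 2 + X + C (1 / 2) ∧
    P 1 aLog 3 =
      X ^ 3 + C (5 / 2) * X ^ 2 + C (5 / 2) * X + C (5 / 6) ∧
    P 1 aLog 4 =
      X ^ 4 + C (13 / 3) * X ^ 3 + C (15 / 2) * X ^ 2 + C (35 / 6) * X
        + C (61 / 36) ∧
    P 1 aLog 5 =
      X ^ 5 + C (77 / 12) * X ^ 4 + C (101 / 6) * X ^ 3 + C (265 / 12) * X ^ 2
        + C (515 / 36) * X + C (2609 / 720) ∧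
    P 1 aLog 6 =
      X ^ 6 + C (87 / 10) * X ^ 5 + C (95 / 3) * X ^ 4 + C 61 * X ^ 3
        + C 65 * X ^ 2 + C (12977 / 360) * X + C (29069 / 3600) := by
  have t1 := T_one aLog
  obtain ⟨t2, t3, t4, t5, t6⟩ := T_log_values
  refine ⟨?_, ?_, ?_, ?_, ?_⟩ <;> refine Polynomial.funext fun x => ?_ <;>
    rw [eval_P _ (by norm_num)] <;>
    simp [invCoeff_succ, invCoeff_zero, Finset.sum_range_succ, *] <;> ring

theorem P_log_one : P 1 aLog 1 = X := by rw [P]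

theorem P_log_zero : P 1 aLog 0 = 1 := by rw [P]

/-! ### Comparison of the two functions -/

theorem T_coeff_comparison (m : ℕ) (hm : m ∈ Finset.Icc 2 6) (j : ℕ) (hj : j < m) :
    0 < (-1) ^ (m + 1) * (T 1 aRad m).coeff j ∧
      (T 1 aRad m).coeff j = (-1) ^ (m + j) * (T 1 aLog m).coeff j := by
  obtain ⟨r2, r3, r4, r5, r6⟩ := T_rad_values
  obtain ⟨l2, l3, l4, l5, l6⟩ := T_log_values
  rw [Finset.mem_Icc] at hm
  obtain ⟨hm1, hm2⟩ := hm
  interval_cases m <;>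
    simp only [r2, r3, r4, r5, r6, l2, l3, l4, l5, l6, ← C_neg, coeff_add, coeff_sub, coeff_neg,
      coeff_C_mul, coeff_X_pow, coeff_X, coeff_C] <;>
    interval_cases j <;> norm_num

theorem P_coeff_comparison (m : ℕ) (hm : m ∈ Finset.Icc 2 6) (j : ℕ) (hj : j ≤ m) :
    0 < (P 1 aLog m).coeff j ∧
      (P 1 aRad m).coeff j = (-1) ^ (m + j) * (P 1 aLog m).coeff j := by
  obtain ⟨r2, r3, r4, r5, r6⟩ := P_rad_values
  obtain ⟨l2, l3, l4, l5, l6⟩ := P_log_values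
  rw [Finset.mem_Icc] at hm
  obtain ⟨hm1, hm2⟩ := hm
  interval_cases m <;>
    simp only [r2, r3, r4, r5, r6, l2, l3, l4, l5, l6, coeff_add, coeff_sub,
      coeff_C_mul, coeff_X_pow, coeff_X, coeff_C] <;>
    interval_cases j <;> norm_num

theorem eval_P_log_neg {m : ℕ} (hm : m ≤ 6) (x : ℝ) :
    (P 1 aLog m).eval (-x) = (-1) ^ m * (P 1 aRad m).eval x := by
  obtain ⟨r2, r3, r4, r5, r6⟩ := P_rad_values
  obtain ⟨l2, l3, l4, l5, l6⟩ := P_log_values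
  interval_cases m <;>
    simp only [P_rad_zero, P_log_zero, P_rad_one, P_log_one, r2, r3, r4, r5, r6, l2, l3, l4, l5, l6,
      eval_add, eval_sub, eval_mul, eval_pow, eval_C, eval_X, eval_one] <;> ring

theorem natDegree_P_rad {m : ℕ} (hm : m ≤ 6) : (P 1 aRad m).natDegree = m := by
  obtain ⟨r2, r3, r4, r5, r6⟩ := P_rad_values
  interval_cases m <;>
    simp only [P_rad_zero, P_rad_one, r2, r3, r4, r5, r6] <;> compute_degree!

theorem coeff_P_rad_self {m : ℕ} (hm : m ≤ 6) : (P 1 aRad m).coeff m = 1 := by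
  obtain ⟨r2, r3, r4, r5, r6⟩ := P_rad_values
  interval_cases m <;>
    simp [P_rad_zero, P_rad_one, r2, r3, r4, r5, r6, coeff_X, coeff_one]

theorem eval_add_eq_sum_hasseDeriv (p : ℝ[X]) (x y : ℝ) :
    p.eval (y + x) = ∑ j ∈ Finset.range (p.natDegree + 1), (hasseDeriv j p).eval x * y ^ j := by
  rw [← taylor_eval, eval_eq_sum_range, natDegree_taylor]
  simp only [taylor_coeff]

theorem expansion_kindred : ∃ Q : ℕ → ℕ → ℝ[X], ∀ m ≤ 6,
    (∀ j ≤ m, (Q m j).natDegree = m - j ∧ 0 < (Q m j).leadingCoeff) ∧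
    (∀ K L : ℝ, (P 1 aRad m).eval (-(b 1 aRad 1 * L - K)) =
      ∑ j ∈ Finset.range (m + 1), (Q m j).eval K * L ^ j) ∧
    (∀ K L : ℝ, (P 1 aLog m).eval (-(b 1 aLog 1 * L + K)) =
      ∑ j ∈ Finset.range (m + 1), ((-1) ^ m * (Q m j).eval K) * L ^ j) := by
  -- The Hasse derivatives are the Taylor coefficients of `P_m(K + L)` in powers of `L`. As `P_m` is
  -- monic, the leading coefficient of the `j`-th one is `m.choose j`.
  refine ⟨fun m j => hasseDeriv j (P 1 aRad m), fun m hm => ⟨fun j hj => ?_, fun K L => ?_,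
    fun K L => ?_⟩⟩
  · have h : (hasseDeriv j (P 1 aRad m)).natDegree = m - j := by
      rw [natDegree_hasseDeriv, natDegree_P_rad hm]
    refine ⟨h, ?_⟩
    rw [leadingCoeff, h, hasseDeriv_coeff, Nat.sub_add_cancel hj, coeff_P_rad_self hm, mul_one]
    exact_mod_cast Nat.choose_pos hj
  · rw [b_rad_values.1, show -(-1 * L - K) = L + K by ring, eval_add_eq_sum_hasseDeriv,
      natDegree_P_rad hm]
  · rw [b_log_values.1, one_mul, eval_P_log_neg hm, eval_add_eq_sum_hasseDeriv,
      natDegree_P_rad hm, Finset.mul_sum]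
    exact Finset.sum_congr rfl fun j _ => by ring

/-! ### The approximate Abel function -/

/-- The polynomial part of the approximate Abel function of `z ↦ z (1 + z)`. -/
noncomputable def abelPoly (z : ℝ) : ℝ :=
  1 / 2 * z - 1 / 3 * z ^ 2 + 13 / 36 * z ^ 3 - 113 / 240 * z ^ 4 + 1187 / 1800 * z ^ 5

/-- An approximate Abel function of `z ↦ z (1 + z)` near the origin. -/
noncomputable def abel (z : ℝ) : ℝ := 1 / z - Real.log z + abelPoly z

theorem exists_bound_of_continuous {Q : ℝ × ℝ → ℝ} (hQ : Continuous Q) :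
    ∃ M, 0 ≤ M ∧ ∀ x y : ℝ, |x| ≤ 1 → |y| ≤ 1 → |Q (x, y)| ≤ M := by
  obtain ⟨M, hM⟩ := (isCompact_Icc.prod isCompact_Icc :
    IsCompact (Set.Icc (-1 : ℝ) 1 ×ˢ Set.Icc (-1 : ℝ) 1)).exists_bound_of_continuousOn
      hQ.continuousOn
  refine ⟨max M 0, le_max_right _ _, fun x y hx hy => (hM (x, y) ?_).trans (le_max_left _ _)⟩
  exact ⟨abs_le.1 hx, abs_le.1 hy⟩

theorem abs_log_one_add_add_sum_le {x : ℝ} (hx : |x| ≤ 1 / 2) (n : ℕ) :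
    |Real.log (1 + x) + ∑ i ∈ Finset.range n, (-x) ^ (i + 1) / (i + 1)| ≤ 2 * |x| ^ (n + 1) := by
  have h := Real.abs_log_sub_add_sum_range_le (x := -x) (by rw [abs_neg]; linarith) n
  rw [abs_neg, sub_neg_eq_add, add_comm] at h
  refine h.trans ?_
  rw [div_le_iff₀ (by linarith)]
  nlinarith [pow_nonneg (abs_nonneg x) (n + 1)]

theorem one_half_le_one_add {x : ℝ} (hx : |x| ≤ 1 / 2) : 1 / 2 ≤ 1 + x := by
  linarith [(abs_le.1 hx).1]

/-- The difference is `1 / (1 + z) + log (1 + z)` plus that of the polynomial parts; the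
coefficients `c_i` are exactly those that cancel every power from `z` to `z ^ 6`. -/
theorem abel_sub_abel_comp_sub_one : ∃ M, 0 ≤ M ∧ ∀ z : ℝ, z ≠ 0 → |z| ≤ 1 / 2 →
    |abel z - abel (z * (1 + z)) - 1| ≤ M * |z| ^ 7 := by
  -- The coefficients of `z ^ 7, …, z ^ 10` in `abelPoly z - abelPoly (z * (1 + z))`.
  obtain ⟨M, hM0, hM⟩ := exists_bound_of_continuous (Q := fun p : ℝ × ℝ =>
    -(4 * (-113 / 240) + 10 * (1187 / 1800)) - (-113 / 240 + 10 * (1187 / 1800)) * p.1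
      - 5 * (1187 / 1800) * p.1 ^ 2 - 1187 / 1800 * p.1 ^ 3) (by fun_prop)
  -- Of the extra `4`, the logarithmic tail contributes `2` and the geometric tail `z ^ 7 / (1 + z)`
  -- contributes `2`.
  refine ⟨M + 4, by linarith, fun z hz hz2 => ?_⟩
  have h1 : 1 / 2 ≤ 1 + z := one_half_le_one_add hz2
  have h1' : 1 + z ≠ 0 := by linarith
  have hlog := abs_log_one_add_add_sum_le hz2 6
  have hR := hM z 0 (by linarith) (by norm_num)
  have hg : |z ^ 7 / (1 + z)| ≤ 2 * |z| ^ 7 := by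
    rw [abs_div, abs_pow, abs_of_pos (show 0 < 1 + z by linarith), div_le_iff₀ (by linarith)]
    nlinarith [pow_nonneg (abs_nonneg z) 7]
  have key : abel z - abel (z * (1 + z)) - 1 =
      (Real.log (1 + z) + ∑ i ∈ Finset.range 6, (-z) ^ (i + 1) / (i + 1)) - z ^ 7 / (1 + z) +
      z ^ 7 * (-(4 * (-113 / 240) + 10 * (1187 / 1800)) - (-113 / 240 + 10 * (1187 / 1800)) * z
        - 5 * (1187 / 1800) * z ^ 2 - 1187 / 1800 * z ^ 3) := by
    simp only [abel, abelPoly, Real.log_mul hz h1', Finset.sum_range_succ, Finset.sum_range_zero]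
    push_cast
    field_simp
    ring
  rw [key]
  refine (abs_add_le _ _).trans ?_
  rw [abs_mul, abs_pow]
  have := abs_sub (Real.log (1 + z) + ∑ i ∈ Finset.range 6, (-z) ^ (i + 1) / (i + 1))
    (z ^ 7 / (1 + z))
  nlinarith [mul_le_mul_of_nonneg_left hR (pow_nonneg (abs_nonneg z) 7)]

/-- Apply `log u ≤ u - 1` to `u = z / z'` and to its inverse. Negative arguments are allowed because
`Real.log` is even; only equality of signs matters. -/
theorem abs_log_sub_log_le {z z' : ℝ} (h : 0 < z * z') {δ : ℝ} (hz : |z| ≤ δ) (hz' : |z'| ≤ δ) :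
    |Real.log z - Real.log z'| ≤ δ * |1 / z - 1 / z'| := by
  have hz0 : z ≠ 0 := left_ne_zero_of_mul h.ne'
  have hz0' : z' ≠ 0 := right_ne_zero_of_mul h.ne'
  have key : ∀ x y : ℝ, 0 < x * y → |x| ≤ δ →
      Real.log x - Real.log y ≤ δ * |1 / x - 1 / y| := by
    intro x y hxy hx
    have hx0 : x ≠ 0 := left_ne_zero_of_mul hxy.ne'
    have hy0 : y ≠ 0 := right_ne_zero_of_mul hxy.ne'
    have hpos : 0 < x / y := by
      rw [show x / y = x * y / y ^ 2 by field_simp]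
      positivity
    rw [← Real.log_div hx0 hy0]
    refine (Real.log_le_sub_one_of_pos hpos).trans ?_
    rw [show x / y - 1 = x * -(1 / x - 1 / y) by field_simp; ring]
    refine (le_abs_self _).trans ?_
    rw [abs_mul, abs_neg]
    exact mul_le_mul_of_nonneg_right hx (abs_nonneg _)
  rw [abs_le]
  constructor
  · have := key z' z (by rwa [mul_comm]) hz'
    rw [abs_sub_comm] at this
    linarith
  · exact key z z' h hz

theorem abel_sub_abel_sub_inv : ∃ δ, 0 < δ ∧ ∀ z z' : ℝ, 0 < z * z' → |z| ≤ δ → |z'| ≤ δ →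
    |abel z - abel z' - (1 / z - 1 / z')| ≤ 1 / 2 * |1 / z - 1 / z'| := by
  obtain ⟨M, hM0, hM⟩ := exists_bound_of_continuous (Q := fun p : ℝ × ℝ =>
    1 / 2 - 1 / 3 * (p.1 + p.2) + 13 / 36 * (p.1 ^ 2 + p.1 * p.2 + p.2 ^ 2)
      - 113 / 240 * (p.1 ^ 3 + p.1 ^ 2 * p.2 + p.1 * p.2 ^ 2 + p.2 ^ 3)
      + 1187 / 1800 * (p.1 ^ 4 + p.1 ^ 3 * p.2 + p.1 ^ 2 * p.2 ^ 2 + p.1 * p.2 ^ 3 + p.2 ^ 4))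
    (by fun_prop)
  -- This radius makes the logarithmic and the polynomial part each contribute at most a quarter of
  -- `|1 / z - 1 / z'|`.
  refine ⟨1 / (4 * (M + 1)), by positivity, fun z z' h hz hz' => ?_⟩
  have hδ : 1 / (4 * (M + 1)) ≤ 1 / 4 := by
    apply one_div_le_one_div_of_le <;> linarith
  have hδM : M * (1 / (4 * (M + 1))) ≤ 1 / 4 := by
    rw [mul_one_div, div_le_div_iff₀] <;> linarith
  have hz0 : z ≠ 0 := left_ne_zero_of_mul h.ne'
  have hz0' : z' ≠ 0 := right_ne_zero_of_mul h.ne'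
  have hlog := (abs_log_sub_log_le h hz hz').trans
    (mul_le_mul_of_nonneg_right hδ (abs_nonneg _))
  have hpoly : |abelPoly z - abelPoly z'| ≤ 1 / 4 * |1 / z - 1 / z'| := by
    have hR := hM z z' (by linarith) (by linarith)
    have : abelPoly z - abelPoly z' = -((1 / 2 - 1 / 3 * (z + z')
      + 13 / 36 * (z ^ 2 + z * z' + z' ^ 2)
      - 113 / 240 * (z ^ 3 + z ^ 2 * z' + z * z' ^ 2 + z' ^ 3)
      + 1187 / 1800 * (z ^ 4 + z ^ 3 * z' + z ^ 2 * z' ^ 2 + z * z' ^ 3 + z' ^ 4)) * z * z' *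
        (1 / z - 1 / z')) := by
      simp only [abelPoly]; field_simp; ring
    rw [this, abs_neg, abs_mul, abs_mul, abs_mul]
    refine mul_le_mul_of_nonneg_right ?_ (abs_nonneg _)
    calc _ ≤ M * (1 / (4 * (M + 1))) * 1 := by
          gcongr
          linarith
      _ ≤ 1 / 4 := by linarith
  have : abel z - abel z' - (1 / z - 1 / z') =
      -(Real.log z - Real.log z') + (abelPoly z - abelPoly z') := by
    simp only [abel]; ring
  rw [this]
  refine (abs_add_le _ _).trans ?_
  rw [abs_neg]
  linarith

/-! ### Abel values of the truncated expansion -/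

/-- The reversed polynomials `t ^ m * P_m (1 / t)` of the radical function, `1 ≤ m ≤ 6`. -/
noncomputable def revP : ℕ → ℝ → ℝ
  | 1, _ => 1
  | 2, t => 1 - t + 1 / 2 * t ^ 2
  | 3, t => 1 - 5 / 2 * t + 5 / 2 * t ^ 2 - 5 / 6 * t ^ 3
  | 4, t => 1 - 13 / 3 * t + 15 / 2 * t ^ 2 - 35 / 6 * t ^ 3 + 61 / 36 * t ^ 4
  | 5, t => 1 - 77 / 12 * t + 101 / 6 * t ^ 2 - 265 / 12 * t ^ 3 + 515 / 36 * t ^ 4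
      - 2609 / 720 * t ^ 5
  | 6, t => 1 - 87 / 10 * t + 95 / 3 * t ^ 2 - 61 * t ^ 3 + 65 * t ^ 4 - 12977 / 360 * t ^ 5
      + 29069 / 3600 * t ^ 6
  | _, _ => 0

theorem eval_P_rad_eq_revP {m : ℕ} (h1 : 1 ≤ m) (h6 : m ≤ 6) {q : ℝ} (hq : q ≠ 0) :
    (P 1 aRad m).eval q = q ^ m * revP m (1 / q) := by
  obtain ⟨r2, r3, r4, r5, r6⟩ := P_rad_values
  interval_cases m <;>
    simp only [P_rad_one, r2, r3, r4, r5, r6, revP, eval_add, eval_sub, eval_mul, eval_pow, eval_C,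
      eval_X] <;> field_simp

/-- The coefficients of `1 / (1 + ∑ revP m t * ρ ^ m)` as a power series in `ρ`. -/
noncomputable def revInv : ℕ → ℝ → ℝ
  | 1, _ => -1
  | 2, t => t - 1 / 2 * t ^ 2
  | 3, t => 1 / 2 * t - 3 / 2 * t ^ 2 + 5 / 6 * t ^ 3
  | 4, t => 1 / 3 * t - 2 * t ^ 2 + 19 / 6 * t ^ 3 - 13 / 9 * t ^ 4
  | 5, t => 1 / 4 * t - 7 / 3 * t ^ 2 + 27 / 4 * t ^ 3 - 15 / 2 * t ^ 4 + 2009 / 720 * t ^ 5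
  | 6, t => 1 / 5 * t - 31 / 12 * t ^ 2 + 34 / 3 * t ^ 3 - 87 / 4 * t ^ 4 + 3359 / 180 * t ^ 5
      - 6973 / 1200 * t ^ 6
  | _, _ => 0

/-- `(∑ revP m t * ρ ^ m) / ρ` and its successive tails are `revTail 1, revTail 2, …`. -/
noncomputable def revTail (k : ℕ) (ρ t : ℝ) : ℝ :=
  ∑ i ∈ Finset.range (7 - k), revP (i + k) t * ρ ^ i

theorem revTail_eq {k : ℕ} (hk : k ≤ 6) (ρ t : ℝ) :
    revTail k ρ t = revP k t + ρ * revTail (k + 1) ρ t := by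
  rw [revTail, show 7 - k = 6 - k + 1 by omega, Finset.sum_range_succ', revTail,
    show 7 - (k + 1) = 6 - k by omega, Finset.mul_sum, add_comm]
  congr 1
  · simp
  · refine Finset.sum_congr rfl fun i _ => ?_
    rw [show i + 1 + k = i + (k + 1) by omega]; ring

theorem continuous_revP (k : ℕ) : Continuous (revP k) := by
  match k with
  | 0 | 1 | 2 | 3 | 4 | 5 | 6 | _ + 7 => unfold revP; fun_prop

theorem continuous_revTail (k : ℕ) : Continuous fun p : ℝ × ℝ => revTail k p.1 p.2 := by
  have := continuous_revP
  unfold revTail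
  fun_prop

/-- Here `revInv m t = t ^ m * T_m(-1 / t)`, so this is the reciprocal relation between the `P_m`
and the `T_m` in the variables `ρ = s q`, `t = 1 / q`. Both variables stay bounded, so continuity of
`Q` yields a uniform constant. -/
theorem one_add_mul_revInv : ∃ Q : ℝ × ℝ → ℝ, Continuous Q ∧ ∀ ρ t : ℝ,
    (1 + ρ * revTail 1 ρ t) * (1 + (revInv 1 t * ρ + revInv 2 t * ρ ^ 2 + revInv 3 t * ρ ^ 3 +
      revInv 4 t * ρ ^ 4 + revInv 5 t * ρ ^ 5 + revInv 6 t * ρ ^ 6)) = 1 + ρ ^ 7 * Q (ρ, t) := by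
  refine ⟨fun p =>
    (revP 1 p.2 * revInv 6 p.2 + revP 2 p.2 * revInv 5 p.2 + revP 3 p.2 * revInv 4 p.2 +
      revP 4 p.2 * revInv 3 p.2 + revP 5 p.2 * revInv 2 p.2 + revP 6 p.2 * revInv 1 p.2) +
    p.1 * (revP 2 p.2 * revInv 6 p.2 + revP 3 p.2 * revInv 5 p.2 + revP 4 p.2 * revInv 4 p.2 +
      revP 5 p.2 * revInv 3 p.2 + revP 6 p.2 * revInv 2 p.2) +
    p.1 ^ 2 * (revP 3 p.2 * revInv 6 p.2 + revP 4 p.2 * revInv 5 p.2 + revP 5 p.2 * revInv 4 p.2 +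
      revP 6 p.2 * revInv 3 p.2) +
    p.1 ^ 3 * (revP 4 p.2 * revInv 6 p.2 + revP 5 p.2 * revInv 5 p.2 + revP 6 p.2 * revInv 4 p.2) +
    p.1 ^ 4 * (revP 5 p.2 * revInv 6 p.2 + revP 6 p.2 * revInv 5 p.2) +
    p.1 ^ 5 * (revP 6 p.2 * revInv 6 p.2), ?_, fun ρ t => ?_⟩
  · simp only [revP, revInv]
    fun_prop
  · simp only [revTail, Finset.sum_range_succ, Finset.sum_range_zero, revP, revInv]
    ring

/-- The equation `s * abel (truncExp s q) = 1 - s log s - s q`, written with `s = t ρ` and with the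
reciprocal and the logarithm replaced by truncated series, holds modulo `ρ ^ 7`. -/
theorem abel_remainder_polynomial : ∃ Q : ℝ × ℝ → ℝ, Continuous Q ∧ ∀ ρ t : ℝ,
    (revInv 1 t * ρ + revInv 2 t * ρ ^ 2 + revInv 3 t * ρ ^ 3 + revInv 4 t * ρ ^ 4 +
      revInv 5 t * ρ ^ 5 + revInv 6 t * ρ ^ 6) + ρ +
    t * ρ * ∑ i ∈ Finset.range 5, (-(ρ * revTail 1 ρ t)) ^ (i + 1) / (i + 1) +
    t * ρ * abelPoly (t * ρ * (1 + ρ * revTail 1 ρ t)) = ρ ^ 7 * Q (ρ, t) := by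
  have hQ := continuous_revTail
  let v (k : ℕ) (p : ℝ × ℝ) : ℝ := revTail k p.1 p.2
  let π (k : ℕ) (p : ℝ × ℝ) : ℝ := revP k p.2
  have hv (k : ℕ) : Continuous (v k) := hQ k
  have hπ (k : ℕ) : Continuous (π k) := (continuous_revP k).comp continuous_snd
  refine ⟨fun p =>
    -p.2 * (v 6 p - 1 / 2 * (2 * v 5 p + 2 * π 2 p * v 4 p + v 3 p ^ 2)
      + 1 / 3 * (3 * v 4 p + 6 * π 2 p * v 3 p + 3 * p.1 * v 3 p ^ 2 + v 2 p ^ 3)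
      - 1 / 4 * (4 * v 3 p + 6 * v 2 p ^ 2 + 4 * p.1 * v 2 p ^ 3 + p.1 ^ 2 * v 2 p ^ 4)
      + 1 / 5 * (5 * v 2 p + 10 * p.1 * v 2 p ^ 2 + 10 * p.1 ^ 2 * v 2 p ^ 3
        + 5 * p.1 ^ 3 * v 2 p ^ 4 + p.1 ^ 4 * v 2 p ^ 5))
    + 1 / 2 * p.2 ^ 2 * v 5 p
    - 1 / 3 * p.2 ^ 3 * (2 * v 4 p + 2 * v 3 p + v 2 p ^ 2)
    + 13 / 36 * p.2 ^ 4 * (3 * v 3 p + 3 * (2 * v 2 p + p.1 * v 2 p ^ 2) + v 1 p ^ 3)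
    - 113 / 240 * p.2 ^ 5 * (4 * v 2 p + 6 * v 1 p ^ 2 + 4 * p.1 * v 1 p ^ 3 + p.1 ^ 2 * v 1 p ^ 4)
    + 1187 / 1800 * p.2 ^ 6 * (5 * v 1 p + 10 * p.1 * v 1 p ^ 2 + 10 * p.1 ^ 2 * v 1 p ^ 3
        + 5 * p.1 ^ 3 * v 1 p ^ 4 + p.1 ^ 4 * v 1 p ^ 5), by fun_prop, fun ρ t => ?_⟩
  have h1 := revTail_eq (k := 1) (by norm_num) ρ t
  have h2 := revTail_eq (k := 2) (by norm_num) ρ t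
  have h3 := revTail_eq (k := 3) (by norm_num) ρ t
  have h4 := revTail_eq (k := 4) (by norm_num) ρ t
  have h5 := revTail_eq (k := 5) (by norm_num) ρ t
  simp only [v, π]
  norm_num only at h1 h2 h3 h4 h5
  generalize revTail 1 ρ t = v1 at *
  generalize revTail 2 ρ t = v2 at *
  generalize revTail 3 ρ t = v3 at *
  generalize revTail 4 ρ t = v4 at *
  generalize revTail 5 ρ t = v5 at *
  generalize revTail 6 ρ t = v6 at *
  have hp : revP 1 t = 1 := rfl
  rw [hp] at h1
  -- Each power is expanded only until its prefactor completes `ρ ^ 7`. What remains is expressed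
  -- through the tails, which act as independent variables and keep the polynomial identities small.
  have k1 : v1 = 1 + ρ * (revP 2 t + ρ * (revP 3 t + ρ * (revP 4 t + ρ * revP 5 t))) +
      ρ ^ 5 * v6 := by
    rw [h1, h2, h3, h4, h5]; ring
  have k2 : v1 ^ 2 = 1 + 2 * ρ * (revP 2 t + ρ * (revP 3 t + ρ * revP 4 t)) +
      ρ ^ 2 * (revP 2 t ^ 2 + 2 * revP 2 t * ρ * revP 3 t) +
      ρ ^ 4 * (2 * v5 + 2 * revP 2 t * v4 + v3 ^ 2) := by
    rw [h1, h2, h3, h4]; ring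
  have k3 : v1 ^ 3 = 1 + 3 * ρ * (revP 2 t + ρ * revP 3 t) + 3 * ρ ^ 2 * revP 2 t ^ 2 +
      ρ ^ 3 * (3 * v4 + 6 * revP 2 t * v3 + 3 * ρ * v3 ^ 2 + v2 ^ 3) := by
    rw [h1, h2, h3]; ring
  have k4 : v1 ^ 4 = 1 + 4 * ρ * revP 2 t +
      ρ ^ 2 * (4 * v3 + 6 * v2 ^ 2 + 4 * ρ * v2 ^ 3 + ρ ^ 2 * v2 ^ 4) := by
    rw [h1, h2]; ring
  have k5 : v1 ^ 5 = 1 + ρ * (5 * v2 + 10 * ρ * v2 ^ 2 + 10 * ρ ^ 2 * v2 ^ 3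
      + 5 * ρ ^ 3 * v2 ^ 4 + ρ ^ 4 * v2 ^ 5) := by
    rw [h1]; ring
  have m1 : 1 + ρ * v1 = 1 + ρ * (1 + ρ * (revP 2 t + ρ * (revP 3 t + ρ * revP 4 t))) +
      ρ ^ 5 * v5 := by
    rw [h1, h2, h3, h4]; ring
  have m2 : (1 + ρ * v1) ^ 2 = 1 + 2 * ρ * (1 + ρ * (revP 2 t + ρ * revP 3 t)) +
      ρ ^ 2 * (1 + 2 * ρ * revP 2 t) + ρ ^ 4 * (2 * v4 + 2 * v3 + v2 ^ 2) := by
    rw [h1, h2, h3]; ring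
  have m3 : (1 + ρ * v1) ^ 3 = 1 + 3 * ρ * (1 + ρ * revP 2 t) + 3 * ρ ^ 2 +
      ρ ^ 3 * (3 * v3 + 3 * (2 * v2 + ρ * v2 ^ 2) + v1 ^ 3) := by
    rw [h1, h2]; ring
  have m4 : (1 + ρ * v1) ^ 4 = 1 + 4 * ρ +
      ρ ^ 2 * (4 * v2 + 6 * v1 ^ 2 + 4 * ρ * v1 ^ 3 + ρ ^ 2 * v1 ^ 4) := by
    rw [h1]; ring
  have m5 : (1 + ρ * v1) ^ 5 = 1 + ρ * (5 * v1 + 10 * ρ * v1 ^ 2 + 10 * ρ ^ 2 * v1 ^ 3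
      + 5 * ρ ^ 3 * v1 ^ 4 + ρ ^ 4 * v1 ^ 5) := by
    ring
  have e1 : ∑ i ∈ Finset.range 5, (-(ρ * v1)) ^ (i + 1) / ((i : ℝ) + 1) =
      -ρ * v1 + 1 / 2 * ρ ^ 2 * v1 ^ 2 - 1 / 3 * ρ ^ 3 * v1 ^ 3 + 1 / 4 * ρ ^ 4 * v1 ^ 4
        - 1 / 5 * ρ ^ 5 * v1 ^ 5 := by
    simp only [Finset.sum_range_succ, Finset.sum_range_zero]
    push_cast
    ring
  have e2 : t * ρ * abelPoly (t * ρ * (1 + ρ * v1)) =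
      1 / 2 * (t * ρ) ^ 2 * (1 + ρ * v1) - 1 / 3 * (t * ρ) ^ 3 * (1 + ρ * v1) ^ 2
      + 13 / 36 * (t * ρ) ^ 4 * (1 + ρ * v1) ^ 3 - 113 / 240 * (t * ρ) ^ 5 * (1 + ρ * v1) ^ 4
      + 1187 / 1800 * (t * ρ) ^ 6 * (1 + ρ * v1) ^ 5 := by
    simp only [abelPoly, mul_pow]
    ring
  rw [e1, e2]
  simp only [revP, revInv] at k1 k2 k3 k4 m1 m2 m3 ⊢
  linear_combination (-t * ρ ^ 2) * k1 + (1 / 2 * t * ρ ^ 3) * k2 - (1 / 3 * t * ρ ^ 4) * k3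
    + (1 / 4 * t * ρ ^ 5) * k4 - (1 / 5 * t * ρ ^ 6) * k5 + (1 / 2 * (t * ρ) ^ 2) * m1
    - (1 / 3 * (t * ρ) ^ 3) * m2 + (13 / 36 * (t * ρ) ^ 4) * m3
    - (113 / 240 * (t * ρ) ^ 5) * m4 + (1187 / 1800 * (t * ρ) ^ 6) * m5

/-- The truncated expansion `s * (1 + ∑ P_m(q) * s ^ m)` of the radical function. -/
noncomputable def truncExp (s q : ℝ) : ℝ :=
  s * (1 + ∑ m ∈ Finset.Icc 1 6, (P 1 aRad m).eval q * s ^ m)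

theorem truncExp_eq_revTail {s q : ℝ} (hq : q ≠ 0) :
    truncExp s q = s * (1 + s * q * revTail 1 (s * q) (1 / q)) := by
  rw [truncExp, show Finset.Icc 1 6 = Finset.Ico (0 + 1) (6 + 1) from rfl,
    ← Finset.sum_Ico_add', ← Finset.range_eq_Ico, revTail, Finset.mul_sum]
  congr 2
  refine Finset.sum_congr rfl fun i hi => ?_
  rw [Finset.mem_range] at hi
  rw [eval_P_rad_eq_revP (by omega) (by omega) hq]
  ring

theorem abel_truncExp : ∃ M δ, 0 ≤ M ∧ 0 < δ ∧ ∀ s q : ℝ, s ≠ 0 → 1 ≤ |q| → |s * q| ≤ δ →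
    (∃ w, |w| ≤ 1 / 2 ∧ truncExp s q = s * (1 + w)) ∧
    |abel (truncExp s q) - (1 / s - Real.log s - q)| ≤ M * (|s| ^ 6 * |q| ^ 7) := by
  obtain ⟨Q1, hQ1, h1⟩ := one_add_mul_revInv
  obtain ⟨Q2, hQ2, h2⟩ := abel_remainder_polynomial
  obtain ⟨M1, hM1, hb1⟩ := exists_bound_of_continuous hQ1
  obtain ⟨M2, hM2, hb2⟩ := exists_bound_of_continuous hQ2
  obtain ⟨M3, hM3, hb3⟩ := exists_bound_of_continuous (continuous_revTail 1)
  -- The three terms bound the errors of the reciprocal (where `1 + w ≥ 1 / 2` costs a factor `2`),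
  -- of the polynomial identity, and of the logarithm. The radius ensures `|w| ≤ 1 / 2` for `w = s q
  -- v`.
  refine ⟨2 * M1 + M2 + 2 * M3 ^ 6, 1 / (2 * (M3 + 1)), by positivity, by positivity,
    fun s q hs hq hsq => ?_⟩
  have hq0 : q ≠ 0 := by rintro rfl; norm_num at hq
  have ht : |1 / q| ≤ 1 := by
    rw [abs_div, abs_one, div_le_one (by linarith)]; exact hq
  have hst : 1 / q * (s * q) = s := by field_simp
  have hδ : 1 / (2 * (M3 + 1)) ≤ 1 / 2 := by
    apply one_div_le_one_div_of_le <;> linarith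
  have hδM : 1 / (2 * (M3 + 1)) * M3 ≤ 1 / 2 := by
    rw [one_div_mul_eq_div, div_le_div_iff₀] <;> linarith
  rw [truncExp_eq_revTail hq0]
  have hρ : |s * q| ≤ 1 := by linarith
  replace h1 := h1 (s * q) (1 / q)
  replace h2 := h2 (s * q) (1 / q)
  replace hb1 := hb1 (s * q) (1 / q) hρ ht
  replace hb2 := hb2 (s * q) (1 / q) hρ ht
  replace hb3 := hb3 (s * q) (1 / q) hρ ht
  rw [hst] at h2
  generalize Q1 (s * q, 1 / q) = A1 at *
  generalize Q2 (s * q, 1 / q) = A2 at *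
  simp only at hb3
  generalize revTail 1 (s * q) (1 / q) = v at *
  generalize hE : revInv 1 (1 / q) * (s * q) + revInv 2 (1 / q) * (s * q) ^ 2 +
    revInv 3 (1 / q) * (s * q) ^ 3 + revInv 4 (1 / q) * (s * q) ^ 4 +
    revInv 5 (1 / q) * (s * q) ^ 5 + revInv 6 (1 / q) * (s * q) ^ 6 = E at *
  have hw : |s * q * v| ≤ 1 / 2 := by
    rw [abs_mul]
    calc _ ≤ 1 / (2 * (M3 + 1)) * M3 := by gcongr
      _ ≤ _ := hδM
  refine ⟨⟨_, hw, rfl⟩, ?_⟩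
  have hw1 := one_half_le_one_add hw
  have hw1' : 1 + s * q * v ≠ 0 := by linarith
  have hlog := abs_log_one_add_add_sum_le hw 5
  generalize hΛ : ∑ i ∈ Finset.range 5, (-(s * q * v)) ^ (i + 1) / ((i : ℝ) + 1) = Λ at *
  -- Multiplying by `s` makes every term polynomial in `ρ` and `t` up to controlled errors of order
  -- `ρ ^ 7`; dividing by `|s|` at the end gives `|s| ^ 6 * |q| ^ 7`.
  have key : s * (abel (s * (1 + s * q * v)) - (1 / s - Real.log s - q)) =
      -((s * q) ^ 7 * (A1 / (1 + s * q * v))) + (s * q) ^ 7 * A2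
        - s * (Real.log (1 + s * q * v) + Λ) := by
    have : 1 / (1 + s * q * v) = 1 + E - (s * q) ^ 7 * (A1 / (1 + s * q * v)) := by
      field_simp
      linear_combination -h1
    rw [abel, Real.log_mul hs hw1', ← h2]
    have h3 : s * (1 / (s * (1 + s * q * v))) = 1 / (1 + s * q * v) := by field_simp
    have h4 : s * (1 / s) = 1 := by field_simp
    linear_combination h3 + this - h4
  have hA1 : |A1 / (1 + s * q * v)| ≤ 2 * M1 := by
    rw [abs_div, abs_of_pos (show 0 < 1 + s * q * v by linarith), div_le_iff₀ (by linarith)]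
    nlinarith
  have hv : |s * q * v| ^ 6 ≤ |s * q| ^ 6 * M3 ^ 6 := by
    rw [abs_mul, mul_pow]
    gcongr
  -- The logarithm was expanded to order five only. The missing power of `ρ` comes from the factor
  -- `s`, since `|q| ≥ 1`.
  have hs7 : |s| * |s * q| ^ 6 ≤ |s * q| ^ 7 := by
    rw [abs_mul, mul_pow, mul_pow]
    have := pow_le_pow_right₀ hq (show 6 ≤ 7 by norm_num)
    nlinarith [mul_le_mul_of_nonneg_left this (pow_nonneg (abs_nonneg s) 7)]
  have hfin : |s| * |abel (s * (1 + s * q * v)) - (1 / s - Real.log s - q)| ≤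
      |s| * ((2 * M1 + M2 + 2 * M3 ^ 6) * (|s| ^ 6 * |q| ^ 7)) := by
    rw [← abs_mul, key]
    have hρ7 : |s| ^ 7 * |q| ^ 7 = |s * q| ^ 7 := by rw [abs_mul, mul_pow]
    calc _ ≤ |s * q| ^ 7 * |A1 / (1 + s * q * v)| + |s * q| ^ 7 * |A2|
          + |s| * |Real.log (1 + s * q * v) + Λ| := by
          refine (abs_sub _ _).trans (add_le_add ((abs_add_le _ _).trans (le_of_eq ?_)) (le_of_eq ?_))
          · rw [abs_neg, abs_mul, abs_mul, abs_pow]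
          · rw [abs_mul]
      _ ≤ |s * q| ^ 7 * (2 * M1) + |s * q| ^ 7 * M2 + |s| * (2 * (|s * q| ^ 6 * M3 ^ 6)) := by
          gcongr
          exact hlog.trans (mul_le_mul_of_nonneg_left hv (by norm_num))
      _ ≤ |s * q| ^ 7 * (2 * M1) + |s * q| ^ 7 * M2 + 2 * M3 ^ 6 * |s * q| ^ 7 := by
          nlinarith [mul_le_mul_of_nonneg_left hs7 (pow_nonneg hM3 6)]
      _ = _ := by rw [← hρ7]; ring
  exact le_of_mul_le_mul_left hfin (abs_pos.2 hs)

/-! ### From Abel values to asymptotics in `n` -/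

theorem tendsto_log_natCast : Tendsto (fun n : ℕ => Real.log n) atTop atTop :=
  Real.tendsto_log_atTop.comp tendsto_natCast_atTop_atTop

theorem log_add_isBigO (K : ℝ) :
    (fun n : ℕ => Real.log n + K) =O[atTop] fun n : ℕ => Real.log n := by
  refine (isBigO_refl _ _).add (IsLittleO.isBigO ?_)
  exact isLittleO_const_left.2 (Or.inr (tendsto_norm_atTop_atTop.comp tendsto_log_natCast))

theorem tendsto_log_pow_div (k : ℕ) {l : ℕ} (hl : 1 ≤ l) :
    Tendsto (fun n : ℕ => Real.log n ^ k / (n : ℝ) ^ l) atTop (nhds 0) := by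
  have h : Tendsto (fun n : ℕ => Real.log n ^ k / (n : ℝ)) atTop (nhds 0) :=
    ((Real.isLittleO_pow_log_id_atTop (n := k)).tendsto_div_nhds_zero).comp
      tendsto_natCast_atTop_atTop
  refine squeeze_zero' ?_ ?_ h
  · filter_upwards [tendsto_log_natCast.eventually_ge_atTop 0] with n hn
    positivity
  · filter_upwards [tendsto_log_natCast.eventually_ge_atTop 0, eventually_ge_atTop 1] with n hn hn1
    have : (1 : ℝ) ≤ n := by exact_mod_cast hn1
    gcongr
    exact le_self_pow₀ this (by omega)

theorem one_isBigO_log_pow (k : ℕ) :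
    (fun _ : ℕ => (1 : ℝ)) =O[atTop] fun n : ℕ => Real.log n ^ k := by
  refine IsBigO.of_bound 1 ?_
  filter_upwards [tendsto_log_natCast.eventually_ge_atTop 1] with n hn
  rw [norm_one, one_mul, norm_pow, Real.norm_eq_abs]
  exact one_le_pow₀ (hn.trans (le_abs_self _))

theorem abel_truncExp_isBigO {ε : ℝ} (hε : |ε| = 1) (K : ℝ) :
    (∀ᶠ n : ℕ in atTop, ∃ w, |w| ≤ 1 / 2 ∧
      truncExp (1 / (ε * n)) (Real.log n + K) = 1 / (ε * n) * (1 + w)) ∧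
    (fun n : ℕ => abel (truncExp (1 / (ε * n)) (Real.log n + K)) - (ε * n - K)) =O[atTop]
      fun n : ℕ => Real.log n ^ 7 / (n : ℝ) ^ 6 := by
  obtain ⟨M, δ, hM, hδ, h⟩ := abel_truncExp
  have hε0 : ε ≠ 0 := by rintro rfl; norm_num at hε
  have hlim : Tendsto (fun n : ℕ => (Real.log n + K) / n) atTop (nhds 0) := by
    have h1 := tendsto_log_pow_div 1 le_rfl
    have h2 := (tendsto_const_nhds (x := K)).div_atTop (tendsto_natCast_atTop_atTop (R := ℝ))
    simpa [add_div] using h1.add h2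
  have hev : ∀ᶠ n : ℕ in atTop, (∃ w, |w| ≤ 1 / 2 ∧
      truncExp (1 / (ε * n)) (Real.log n + K) = 1 / (ε * n) * (1 + w)) ∧
      |abel (truncExp (1 / (ε * n)) (Real.log n + K)) - (ε * n - K)| ≤
        M * |(Real.log n + K) ^ 7 / (n : ℝ) ^ 6| := by
    filter_upwards [eventually_ge_atTop 1, tendsto_log_natCast.eventually_ge_atTop (1 - K),
      (hlim.abs.eventually (ge_mem_nhds (by simpa using hδ)))] with n hn1 hn2 hn3
    have hn : (0 : ℝ) < n := by exact_mod_cast hn1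
    have hs : |1 / (ε * n)| = 1 / n := by
      rw [abs_div, abs_mul, hε, one_mul, abs_one, Nat.abs_cast]
    have := h (1 / (ε * n)) (Real.log n + K) (by positivity)
      (le_trans (by linarith) (le_abs_self _))
      (by
        rw [abs_mul, hs, one_div_mul_eq_div, ← Nat.abs_cast n, ← abs_div, Nat.abs_cast]
        exact hn3)
    refine ⟨this.1, ?_⟩
    -- Evenness of `Real.log` removes `ε`, so the term `log n` in `q` cancels against `-log s` for
    -- both signs.
    have hl : Real.log (1 / (ε * n)) = -Real.log n := by
      rw [one_div, Real.log_inv, ← Real.log_abs, abs_mul, hε, one_mul, Nat.abs_cast]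
    have h2 := this.2
    rw [hl, hs, one_div_one_div] at h2
    rw [show ε * n - K = ε * n - -Real.log n - (Real.log n + K) by ring]
    refine h2.trans (le_of_eq ?_)
    rw [abs_div, abs_pow, abs_pow, Nat.abs_cast, one_div, inv_pow]
    ring
  refine ⟨hev.mono fun n hn => hn.1, ?_⟩
  refine (IsBigO.of_bound (g := fun n : ℕ => (Real.log n + K) ^ 7 / (n : ℝ) ^ 6) M
    (hev.mono fun n hn => hn.2)).trans ?_
  simp only [div_eq_mul_inv]
  exact ((log_add_isBigO K).pow 7).mul (isBigO_refl _ _)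

theorem abel_sub_abel_bounds : ∃ δ, 0 < δ ∧ ∀ z z' : ℝ, 0 < z * z' → |z| ≤ δ → |z'| ≤ δ →
    |z - z'| ≤ 2 * (|z| * |z'| * |abel z - abel z'|) ∧
    |z| * |z'| * |abel z - abel z'| ≤ 2 * |z - z'| := by
  obtain ⟨δ, hδ, h⟩ := abel_sub_abel_sub_inv
  refine ⟨δ, hδ, fun z z' hzz hz hz' => ?_⟩
  replace h := h z z' hzz hz hz'
  have hz0 : z ≠ 0 := left_ne_zero_of_mul hzz.ne'
  have hz0' : z' ≠ 0 := right_ne_zero_of_mul hzz.ne'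
  have h1 : |z - z'| = |z| * |z'| * |1 / z - 1 / z'| := by
    rw [← abs_mul, ← abs_mul, show z * z' * (1 / z - 1 / z') = -(z - z') by field_simp; ring,
      abs_neg]
  have h2 := abs_sub_abs_le_abs_sub (abel z - abel z') (1 / z - 1 / z')
  have h3 := abs_sub_abs_le_abs_sub (1 / z - 1 / z') (abel z - abel z')
  rw [abs_sub_comm (1 / z - 1 / z')] at h3
  have h4 : 0 ≤ |z| * |z'| := by positivity
  have h5 : 0 ≤ |1 / z - 1 / z'| := abs_nonneg _
  rw [h1]
  constructor
  · calc _ ≤ |z| * |z'| * (2 * |abel z - abel z'|) := by gcongr; linarith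
      _ = _ := by ring
  · calc _ ≤ |z| * |z'| * (2 * |1 / z - 1 / z'|) := by gcongr; linarith
      _ = _ := by ring

/-- Provides the common sign and the order `1 / n` under which Abel values can be compared; both
estimates come from `1 / 2 ≤ 1 + w ≤ 3 / 2`. -/
theorem truncExp_bounds {ε : ℝ} (hε : |ε| = 1) (K : ℝ) : ∀ᶠ n : ℕ in atTop,
    0 < ε * truncExp (1 / (ε * n)) (Real.log n + K) ∧
    |truncExp (1 / (ε * n)) (Real.log n + K)| ≤ 2 / n ∧
    1 / (2 * n) ≤ |truncExp (1 / (ε * n)) (Real.log n + K)| := by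
  have hε0 : ε ≠ 0 := by rintro rfl; norm_num at hε
  filter_upwards [(abel_truncExp_isBigO hε K).1, eventually_ge_atTop 1] with n ⟨w, hw, hF⟩ hn1
  have hn : (0 : ℝ) < n := by exact_mod_cast hn1
  have hw' := abs_le.1 hw
  have hs : |1 / (ε * n)| = 1 / n := by
    rw [abs_div, abs_mul, hε, one_mul, abs_one, Nat.abs_cast]
  rw [hF, abs_mul, hs, abs_of_pos (show 0 < 1 + w by linarith)]
  refine ⟨?_, ?_, ?_⟩
  · rw [show ε * (1 / (ε * n) * (1 + w)) = 1 / n * (1 + w) by field_simp]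
    have : 0 < 1 + w := by linarith
    positivity
  · rw [one_div_mul_eq_div]
    gcongr
    linarith
  · rw [one_div_mul_eq_div, div_le_div_iff₀ (by positivity) hn]
    nlinarith

theorem mul_pos_of_sign {ε x y : ℝ} (hx : 0 < ε * x) (hy : 0 < ε * y) : 0 < x * y := by
  have h : 0 < ε ^ 2 * (x * y) := by nlinarith [mul_pos hx hy]
  by_contra! hle
  linarith [mul_nonpos_of_nonneg_of_nonpos (sq_nonneg ε) hle]

theorem sub_truncExp_isBigO {ε : ℝ} (hε : |ε| = 1) {z : ℕ → ℝ} {M : ℝ}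
    (hpos : ∀ᶠ n in atTop, 0 < ε * z n) (hz : ∀ᶠ n : ℕ in atTop, |z n| ≤ M / n) {K : ℝ}
    (h : (fun n : ℕ => abel (z n) - (ε * n - K)) =O[atTop] fun n : ℕ => 1 / (n : ℝ) ^ 6) :
    (fun n : ℕ => z n - truncExp (1 / (ε * n)) (Real.log n + K)) =O[atTop]
      fun n : ℕ => Real.log n ^ 7 / (n : ℝ) ^ 8 := by
  obtain ⟨δ, hδ, hb⟩ := abel_sub_abel_bounds
  have hlim (c : ℝ) : ∀ᶠ n : ℕ in atTop, c / (n : ℝ) ≤ δ :=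
    (tendsto_const_nhds.div_atTop tendsto_natCast_atTop_atTop).eventually (ge_mem_nhds hδ)
  have h1 : (fun n : ℕ => 1 / (n : ℝ) ^ 6) =O[atTop] fun n : ℕ => Real.log n ^ 7 / (n : ℝ) ^ 6 := by
    simp only [div_eq_mul_inv]
    exact (one_isBigO_log_pow 7).mul (isBigO_refl _ _)
  have h2 := (h.trans h1).sub (abel_truncExp_isBigO hε K).2
  simp only [sub_sub_sub_cancel_right] at h2
  have h3 : (fun n : ℕ => z n - truncExp (1 / (ε * n)) (Real.log n + K)) =O[atTop] fun n : ℕ =>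
      1 / (n : ℝ) ^ 2 * (abel (z n) - abel (truncExp (1 / (ε * n)) (Real.log n + K))) := by
    -- The product of the comparison constant `2` with the bounds `M / n` and `2 / n`.
    refine IsBigO.of_bound (4 * M) ?_
    filter_upwards [hpos, hz, truncExp_bounds hε K, hlim M, hlim 2, eventually_ge_atTop 1]
      with n hn1 hn2 hn3 hn4 hn5 hn6
    have hn : (0 : ℝ) < n := by exact_mod_cast hn6
    have hM : 0 ≤ M / n := (abs_nonneg _).trans hn2
    refine (hb _ _ (mul_pos_of_sign hn1 hn3.1) (hn2.trans hn4) (hn3.2.1.trans hn5)).1.trans ?_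
    calc _ ≤ 2 * (M / n * (2 / n) *
          |abel (z n) - abel (truncExp (1 / (ε * n)) (Real.log n + K))|) := by
          gcongr
          exact hn3.2.1
      _ = _ := by
          rw [norm_mul, Real.norm_eq_abs, Real.norm_eq_abs,
            abs_of_pos (show 0 < 1 / (n : ℝ) ^ 2 by positivity)]
          field_simp
          ring
  refine h3.trans (((isBigO_refl _ _).mul h2).congr_right fun n => ?_)
  rw [div_mul_div_comm, one_mul, ← pow_add]

theorem eq_of_truncExp_sub_isBigO {ε : ℝ} (hε : |ε| = 1) {K K' : ℝ}
    (h : (fun n : ℕ => truncExp (1 / (ε * n)) (Real.log n + K) -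
      truncExp (1 / (ε * n)) (Real.log n + K')) =O[atTop]
      fun n : ℕ => Real.log n ^ 7 / (n : ℝ) ^ 8) : K = K' := by
  obtain ⟨δ, hδ, hb⟩ := abel_sub_abel_bounds
  have hlim (c : ℝ) : ∀ᶠ n : ℕ in atTop, c / (n : ℝ) ≤ δ :=
    (tendsto_const_nhds.div_atTop tendsto_natCast_atTop_atTop).eventually (ge_mem_nhds hδ)
  have h1 : (fun n : ℕ => abel (truncExp (1 / (ε * n)) (Real.log n + K)) -
      abel (truncExp (1 / (ε * n)) (Real.log n + K'))) =O[atTop] fun n : ℕ => (n : ℝ) ^ 2 *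
      (truncExp (1 / (ε * n)) (Real.log n + K) - truncExp (1 / (ε * n)) (Real.log n + K')) := by
    -- Each expansion has absolute value at least `1 / (2 * n)`, which gives `4 * n ^ 2`; the
    -- comparison contributes another `2`.
    refine IsBigO.of_bound 8 ?_
    filter_upwards [truncExp_bounds hε K, truncExp_bounds hε K', hlim 2, eventually_ge_atTop 1]
      with n hn1 hn2 hn3 hn4
    have hn : (0 : ℝ) < n := by exact_mod_cast hn4
    have := (hb _ _ (mul_pos_of_sign hn1.1 hn2.1) (hn1.2.1.trans hn3) (hn2.2.1.trans hn3)).2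
    have h2 : 1 / (2 * (n : ℝ)) * (1 / (2 * n)) *
        |abel (truncExp (1 / (ε * n)) (Real.log n + K)) -
          abel (truncExp (1 / (ε * n)) (Real.log n + K'))| ≤ _ :=
      le_trans (by gcongr <;> linarith [hn1.2.2, hn2.2.2]) this
    rw [norm_mul, norm_pow, Real.norm_natCast, Real.norm_eq_abs, Real.norm_eq_abs]
    rw [div_mul_div_comm, div_mul_eq_mul_div, div_le_iff₀ (by positivity)] at h2
    linarith
  have h2 : (fun n : ℕ => abel (truncExp (1 / (ε * n)) (Real.log n + K)) -
      abel (truncExp (1 / (ε * n)) (Real.log n + K'))) =O[atTop]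
      fun n : ℕ => Real.log n ^ 7 / (n : ℝ) ^ 6 := by
    refine (h1.trans ((isBigO_refl _ _).mul h)).trans (EventuallyEq.isBigO ?_)
    filter_upwards [eventually_ge_atTop 1] with n hn1
    have hn : (n : ℝ) ≠ 0 := by positivity
    field_simp
  have h3 := (h2.sub (abel_truncExp_isBigO hε K).2).add (abel_truncExp_isBigO hε K').2
  -- The Abel values are `ε n - K` and `ε n - K'` up to vanishing errors, so their difference forces
  -- the constant `K' - K` to tend to zero.
  have h4 : Tendsto (fun _ : ℕ => K' - K) atTop (nhds 0) := by
    refine (h3.trans_tendsto (tendsto_log_pow_div 7 (by norm_num))).congr fun n => ?_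
    ring
  exact (sub_eq_zero.1 (tendsto_nhds_unique tendsto_const_nhds h4)).symm

theorem exists_limit_of_abs_sub_le {a : ℕ → ℝ} {M : ℝ} {N : ℕ} (hM : 0 ≤ M)
    (h : ∀ n ≥ N, |a (n + 1) - a n| ≤ M * (1 / ((n : ℝ) + 1) ^ 7)) :
    ∃ κ, (fun n : ℕ => a n - κ) =O[atTop] fun n : ℕ => 1 / (n : ℝ) ^ 6 := by
  -- A telescoping majorant, which yields the tail bound `O(n ^ (-6))` with an explicit constant.
  have hstep (x : ℝ) (hx : 0 < x) : 1 / (x + 1) ^ 7 ≤ 1 / x ^ 6 - 1 / (x + 1) ^ 6 := by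
    rw [div_sub_div _ _ (by positivity) (by positivity),
      div_le_div_iff₀ (by positivity) (by positivity)]
    have h2 : (x + 1) ^ 5 ≤ (x + 1) ^ 6 - x ^ 6 := by
      have : 0 ≤ (x + 1) ^ 6 - x ^ 6 - (x + 1) ^ 5 := by ring_nf; positivity
      linarith
    have h3 : x ^ 6 ≤ (x + 1) ^ 6 := by gcongr; linarith
    nlinarith [mul_le_mul_of_nonneg_right h2 (show 0 ≤ (x + 1) ^ 7 by positivity),
      mul_le_mul_of_nonneg_right h3 (show 0 ≤ (x + 1) ^ 6 by positivity)]
  have hind (n : ℕ) (hn : N ≤ n) (hn1 : 1 ≤ n) (k : ℕ) :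
      |a (n + k) - a n| ≤ M * (1 / (n : ℝ) ^ 6 - 1 / ((n : ℝ) + k) ^ 6) := by
    induction k with
    | zero => simp
    | succ k ih =>
      have h1 := h (n + k) (by omega)
      have h2 := mul_le_mul_of_nonneg_left (hstep ((n : ℝ) + k) (by positivity)) hM
      push_cast at h1 ⊢
      rw [← add_assoc, ← add_assoc]
      have := abs_sub_le (a (n + k + 1)) (a (n + k)) (a n)
      linarith
  have hle (n : ℕ) (hn : N ≤ n) (hn1 : 1 ≤ n) (m : ℕ) (hm : n ≤ m) :
      |a m - a n| ≤ M * (1 / (n : ℝ) ^ 6) := by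
    obtain ⟨k, rfl⟩ := Nat.exists_eq_add_of_le hm
    refine (hind n hn hn1 k).trans (mul_le_mul_of_nonneg_left ?_ hM)
    have : 0 ≤ 1 / ((n : ℝ) + k) ^ 6 := by positivity
    linarith
  have hcauchy : CauchySeq fun n => a (n + (N + 1)) := by
    refine cauchySeq_of_le_tendsto_0' (fun n => M * (1 / ((n + (N + 1) : ℕ) : ℝ) ^ 6)) ?_ ?_
    · intro n m hnm
      rw [dist_comm, Real.dist_eq]
      exact hle _ (by omega) (by omega) _ (by omega)
    · have h1 : Tendsto (fun n : ℕ => 1 / (n : ℝ) ^ 6) atTop (nhds 0) := by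
        simpa using tendsto_log_pow_div 0 (l := 6) (by norm_num)
      simpa using ((tendsto_add_atTop_iff_nat (N + 1)).2 h1).const_mul M
  obtain ⟨κ, hκ⟩ := cauchySeq_tendsto_of_complete hcauchy
  replace hκ := (tendsto_add_atTop_iff_nat (N + 1)).1 hκ
  refine ⟨κ, IsBigO.of_bound M ?_⟩
  filter_upwards [eventually_ge_atTop (N + 1)] with n hn
  rw [Real.norm_eq_abs, Real.norm_eq_abs, abs_sub_comm,
    abs_of_nonneg (show 0 ≤ 1 / (n : ℝ) ^ 6 by positivity)]
  refine le_of_tendsto ((hκ.sub_const (a n)).abs) ?_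
  filter_upwards [eventually_ge_atTop n] with m hm using hle n (by omega) (by omega) m hm

/-! ### The radical function -/

theorem radical_spec {x : ℝ} (hx : 0 < x) :
    0 < radical x ∧ radical x * (1 + radical x) = x := by
  have h1 : 1 < Real.sqrt (1 + 4 * x) := by
    rw [Real.lt_sqrt (by norm_num)]; linarith
  have h2 := Real.sq_sqrt (show 0 ≤ 1 + 4 * x by linarith)
  rw [radical]
  constructor
  · linarith
  · linear_combination 1 / 4 * h2

theorem radical_iterate_bounds {x₀ : ℝ} (hx : 0 < x₀) (n : ℕ) :
    0 < radical^[n] x₀ ∧ radical^[n] x₀ ≤ x₀ ∧ n * radical^[n] x₀ ≤ 1 + x₀ := by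
  induction n with
  | zero => simp [hx]; linarith
  | succ n ih =>
    obtain ⟨h1, h2, h3⟩ := ih
    rw [Function.iterate_succ_apply']
    obtain ⟨h4, h5⟩ := radical_spec h1
    set x := radical^[n] x₀
    set y := radical x
    have h6 : y ≤ x₀ := by nlinarith
    refine ⟨h4, h6, ?_⟩
    push_cast
    have h7 : n * y * (1 + y) ≤ 1 + x₀ := by rw [mul_assoc, h5]; exact h3
    -- With `y` the next iterate, `(n + 1) y > 1 + x₀` and `n y (1 + y) ≤ 1 + x₀` give `n y < 1`,
    -- whence `(n + 1) y < 1 + y ≤ 1 + x₀`.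
    by_contra! hlt
    nlinarith

theorem radical_iterate_abel {x₀ : ℝ} (hx : 0 < x₀) : ∃ K : ℝ,
    (fun n : ℕ => radical^[n] x₀ - truncExp (1 / (1 * n)) (Real.log n + K)) =O[atTop]
      fun n : ℕ => Real.log n ^ 7 / (n : ℝ) ^ 8 := by
  obtain ⟨M, hM, h⟩ := abel_sub_abel_comp_sub_one
  have hb := radical_iterate_bounds hx
  have hz (n : ℕ) (hn : 1 ≤ n) : |radical^[n] x₀| ≤ (1 + x₀) / n := by
    rw [abs_of_pos (hb n).1, le_div_iff₀ (by positivity), mul_comm]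
    exact (hb n).2.2
  have hsmall : ∀ᶠ n : ℕ in atTop, (1 + x₀) / (n : ℝ) ≤ 1 / 2 :=
    (tendsto_const_nhds.div_atTop tendsto_natCast_atTop_atTop).eventually
      (ge_mem_nhds (by norm_num))
  obtain ⟨N, hN⟩ := eventually_atTop.1 hsmall
  obtain ⟨κ, hκ⟩ := exists_limit_of_abs_sub_le (a := fun n => abel (radical^[n] x₀) - n)
    (M := M * (1 + x₀) ^ 7) (N := N) (by positivity) (fun n hn => by
      -- The map `z ↦ z (1 + z)` runs the radical orbit backwards, so the Abel estimate is applied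
      -- at the later point and the Abel value grows by about `1` per step.
      have h1 := h (radical^[n + 1] x₀) (hb _).1.ne'
        ((hz _ (by omega)).trans (hN _ (by omega)))
      have h2 : radical^[n + 1] x₀ * (1 + radical^[n + 1] x₀) = radical^[n] x₀ := by
        rw [Function.iterate_succ_apply']; exact (radical_spec (hb n).1).2
      rw [h2] at h1
      push_cast
      rw [show abel (radical^[n + 1] x₀) - (n + 1) - (abel (radical^[n] x₀) - n) =
        abel (radical^[n + 1] x₀) - abel (radical^[n] x₀) - 1 by ring]
      refine h1.trans ?_
      have h3 := hz (n + 1) (by omega)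
      push_cast at h3
      calc _ ≤ M * ((1 + x₀) / (n + 1)) ^ 7 := by gcongr
        _ = _ := by rw [div_pow]; ring)
  refine ⟨-κ, sub_truncExp_isBigO (by norm_num) (M := 1 + x₀) ?_ ?_ ?_⟩
  · exact Eventually.of_forall fun n => by rw [one_mul]; exact (hb n).1
  · filter_upwards [eventually_ge_atTop 1] with n hn using hz n hn
  · refine hκ.congr_left fun n => ?_
    ring

theorem expansion_rad (K : ℝ) (n : ℕ) :
    expansion 1 aRad (-K) n = truncExp (1 / (1 * n)) (Real.log n + K) := by
  rw [expansion, truncExp, lam_rad, b_rad_values.1]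
  simp only [Nat.cast_one, div_one, Real.rpow_one, one_mul, one_div, inv_pow]
  rw [show -1 * (-1 * Real.log n + -K) = Real.log n + K by ring]

/-- The display collects the terms `m ≤ 5`, so only the one with `m = 6` is left. -/
theorem expansion_sub_display (K : ℝ) (n : ℕ) : expansion 1 aRad (-K) n -
    display K (Real.log n) n = (P 1 aRad 6).eval (Real.log n + K) / (n : ℝ) ^ 7 := by
  obtain ⟨r2, r3, r4, r5, r6⟩ := P_rad_values
  rw [expansion_rad, truncExp, display]
  simp [Finset.sum_Icc_succ_top, P_rad_one, r2, r3, r4, r5, r6]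
  ring

theorem expansion_sub_display_isBigO (K : ℝ) :
    (fun n : ℕ => expansion 1 aRad (-K) n - display K (Real.log n) n) =O[atTop]
      fun n : ℕ => Real.log n ^ 6 / (n : ℝ) ^ 7 := by
  obtain ⟨M, hM, h⟩ := exists_bound_of_continuous ((continuous_revP 6).comp continuous_fst)
  simp only [expansion_sub_display, div_eq_mul_inv]
  refine IsBigO.mul ?_ (isBigO_refl _ _)
  refine (IsBigO.of_bound (g := fun n : ℕ => (Real.log n + K) ^ 6) M ?_).trans
    ((log_add_isBigO K).pow 6)
  filter_upwards [tendsto_log_natCast.eventually_ge_atTop (1 - K)] with n hn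
  have hq : 1 ≤ Real.log n + K := by linarith
  rw [eval_P_rad_eq_revP (by norm_num) le_rfl (by linarith), norm_mul, mul_comm]
  gcongr
  refine h (1 / (Real.log n + K)) 0 ?_ (by norm_num)
  rw [abs_of_pos (by positivity), div_le_one (by positivity)]
  exact hq

theorem log_pow_seven_div_isBigO : (fun n : ℕ => Real.log n ^ 7 / (n : ℝ) ^ 8) =O[atTop]
    fun n : ℕ => Real.log n ^ 6 / (n : ℝ) ^ 7 := by
  have h := ((tendsto_log_pow_div 1 le_rfl).isBigO_one ℝ).mul
    (isBigO_refl (fun n : ℕ => Real.log n ^ 6 / (n : ℝ) ^ 7) atTop)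
  refine h.congr (fun n => ?_) fun n => one_mul _
  rw [div_mul_div_comm, ← pow_add, ← pow_add]

theorem radical_iterate_asymptotics (x₀ : ℝ) (hx : 0 < x₀) : ∃ K : ℝ,
    ((fun n : ℕ => radical^[n] x₀ - expansion 1 aRad (-K) n) =O[atTop]
      fun n : ℕ => Real.log n ^ 7 / (n : ℝ) ^ 8) ∧
    ((fun n : ℕ => radical^[n] x₀ - display K (Real.log n) n) =O[atTop]
      fun n : ℕ => Real.log n ^ 6 / (n : ℝ) ^ 7) ∧
    (∀ K' : ℝ, ((fun n : ℕ => radical^[n] x₀ - expansion 1 aRad (-K') n) =O[atTop]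
      fun n : ℕ => Real.log n ^ 7 / (n : ℝ) ^ 8) → K' = K) := by
  obtain ⟨K, hK⟩ := radical_iterate_abel hx
  simp only [← expansion_rad] at hK
  refine ⟨K, hK, ?_, fun K' hK' => ?_⟩
  · refine ((hK.trans log_pow_seven_div_isBigO).add
      (expansion_sub_display_isBigO K)).congr_left fun n => ?_
    ring
  · refine eq_of_truncExp_sub_isBigO (ε := 1) (by norm_num) ((hK.sub hK').congr_left fun n => ?_)
    rw [← expansion_rad, ← expansion_rad]
    ring

/-! ### The logistic function -/

theorem logistic_iterate_bounds {x₀ : ℝ} (hx : 0 < x₀) (hx1 : x₀ < 1) (n : ℕ) :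
    0 < logistic^[n] x₀ ∧ logistic^[n] x₀ < 1 ∧ ((n : ℝ) + 1) * logistic^[n] x₀ ≤ 1 := by
  induction n with
  | zero => simp [hx, hx1]; linarith
  | succ n ih =>
    obtain ⟨h1, h2, h3⟩ := ih
    rw [Function.iterate_succ_apply']
    set x := logistic^[n] x₀
    rw [logistic]
    refine ⟨mul_pos h1 (by linarith), by nlinarith, ?_⟩
    push_cast
    nlinarith [mul_le_mul_of_nonneg_right h3 (show 0 ≤ 1 - x by linarith), sq_nonneg x]

theorem logistic_iterate_abel {x₀ : ℝ} (hx : 0 < x₀) (hx1 : x₀ < 1) : ∃ K : ℝ,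
    (fun n : ℕ => -logistic^[n] x₀ - truncExp (1 / (-1 * n)) (Real.log n + K)) =O[atTop]
      fun n : ℕ => Real.log n ^ 7 / (n : ℝ) ^ 8 := by
  obtain ⟨M, hM, h⟩ := abel_sub_abel_comp_sub_one
  have hb := logistic_iterate_bounds hx hx1
  have hz (n : ℕ) : |-logistic^[n] x₀| ≤ 1 / ((n : ℝ) + 1) := by
    rw [abs_neg, abs_of_pos (hb n).1, le_div_iff₀ (by positivity), mul_comm]
    exact (hb n).2.2
  obtain ⟨κ, hκ⟩ := exists_limit_of_abs_sub_le (a := fun n => abel (-logistic^[n] x₀) + n)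
    (M := M) (N := 1) hM (fun n hn => by
      -- Here the orbit runs forwards under `z ↦ z (1 + z)`, so the Abel value falls by about `1`
      -- per step; this is the case `ε = -1`. Starting at `n = 1` makes `1 / (n + 1) ≤ 1 / 2`.
      have h1 := h (-logistic^[n] x₀) (neg_ne_zero.2 (hb _).1.ne') ((hz n).trans (by
        apply one_div_le_one_div_of_le (by norm_num)
        have : (1 : ℝ) ≤ n := by exact_mod_cast hn
        linarith))
      have h2 : -logistic^[n] x₀ * (1 + -logistic^[n] x₀) = -logistic^[n + 1] x₀ := by
        rw [Function.iterate_succ_apply', logistic]; ring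
      rw [h2] at h1
      push_cast
      rw [show abel (-logistic^[n + 1] x₀) + (n + 1) - (abel (-logistic^[n] x₀) + n) =
        -(abel (-logistic^[n] x₀) - abel (-logistic^[n + 1] x₀) - 1) by ring, abs_neg]
      refine h1.trans ?_
      calc _ ≤ M * (1 / ((n : ℝ) + 1)) ^ 7 := by gcongr; exact hz n
        _ = _ := by rw [div_pow, one_pow])
  refine ⟨-κ, sub_truncExp_isBigO (by norm_num) (M := 1) ?_ ?_ ?_⟩
  · exact Eventually.of_forall fun n => by linarith [(hb n).1]
  · filter_upwards [eventually_ge_atTop 1] with n hn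
    have : (0 : ℝ) < n := by exact_mod_cast hn
    exact (hz n).trans (one_div_le_one_div_of_le this (by linarith))
  · refine hκ.congr_left fun n => ?_
    ring

/-- The sign `(-1) ^ m` from the parity relation between the two families `P_m` is absorbed by `s ^
m` with `s = -1 / n`. -/
theorem expansion_log (K : ℝ) (n : ℕ) :
    expansion 1 aLog K n = -truncExp (1 / (-1 * n)) (Real.log n + K) := by
  rw [expansion, truncExp, lam_log, b_log_values.1]
  simp only [Nat.cast_one, div_one, Real.rpow_one, one_mul, neg_mul, one_div, inv_neg, neg_neg]
  congr 2
  refine Finset.sum_congr rfl fun m hm => ?_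
  rw [eval_P_log_neg (Finset.mem_Icc.1 hm).2, neg_pow (n : ℝ)⁻¹, inv_pow]
  ring

theorem logistic_iterate_asymptotics (x₀ : ℝ) (hx : 0 < x₀) (hx1 : x₀ < 1) : ∃! K : ℝ,
    (fun n : ℕ => logistic^[n] x₀ - expansion 1 aLog K n) =O[atTop]
      fun n : ℕ => Real.log n ^ 7 / (n : ℝ) ^ 8 := by
  obtain ⟨K, hK⟩ := logistic_iterate_abel hx hx1
  refine ⟨K, ?_, fun K' hK' => ?_⟩
  · refine hK.neg_left.congr_left fun n => ?_
    rw [expansion_log]; ring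
  -- The estimates are added, not subtracted: one concerns `-x n` and the other `x n`, so the orbit
  -- cancels in the sum.
  · refine eq_of_truncExp_sub_isBigO (ε := -1) (by norm_num)
      ((hK.add hK').congr_left fun n => ?_)
    simp only [expansion_log]
    ring

end IterAsymp

theorem mainTheorem4 :
    -- Data of the algorithm for the radical function (`τ = 1`)
    ((∀ m : Fin 7, IterAsymp.aRad (m + 1) = ![-1, 2, -5, 14, -42, 132, -429] m) ∧
      IterAsymp.lam 1 IterAsymp.aRad = 1 ∧
      (∀ j : Fin 6, IterAsymp.b 1 IterAsymp.aRad (j + 1) = ![-1, 2, -5, 14, -42, 132] j) ∧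
      (∀ j : Fin 6, IterAsymp.aa 1 IterAsymp.aRad 0 (j + 1) =
        ![1, -3 / 2, 10 / 3, -35 / 4, 126 / 5, -77] j) ∧
      (∀ i : Fin 5, IterAsymp.c 1 IterAsymp.aRad (i + 1) =
        ![1 / 2, -1 / 3, 13 / 36, -113 / 240, 1187 / 1800] i)) ∧
    (IterAsymp.T 1 IterAsymp.aRad 2 = -X - C (1 / 2) ∧
      IterAsymp.T 1 IterAsymp.aRad 3 = C (1 / 2) * X ^ 2 + C (3 / 2) * X + C (5 / 6) ∧
      IterAsymp.T 1 IterAsymp.aRad 4 =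
        -C (1 / 3) * X ^ 3 - C 2 * X ^ 2 - C (19 / 6) * X - C (13 / 9) ∧
      IterAsymp.T 1 IterAsymp.aRad 5 =
        C (1 / 4) * X ^ 4 + C (7 / 3) * X ^ 3 + C (27 / 4) * X ^ 2 + C (15 / 2) * X
          + C (2009 / 720) ∧
      IterAsymp.T 1 IterAsymp.aRad 6 =
        -C (1 / 5) * X ^ 5 - C (31 / 12) * X ^ 4 - C (34 / 3) * X ^ 3 - C (87 / 4) * X ^ 2
          - C (3359 / 180) * X - C (6973 / 1200)) ∧
    (IterAsymp.P 1 IterAsymp.aRad 2 = X ^ 2 - X + C (1 / 2) ∧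
      IterAsymp.P 1 IterAsymp.aRad 3 = X ^ 3 - C (5 / 2) * X ^ 2 + C (5 / 2) * X - C (5 / 6) ∧
      IterAsymp.P 1 IterAsymp.aRad 4 =
        X ^ 4 - C (13 / 3) * X ^ 3 + C (15 / 2) * X ^ 2 - C (35 / 6) * X + C (61 / 36) ∧
      IterAsymp.P 1 IterAsymp.aRad 5 =
        X ^ 5 - C (77 / 12) * X ^ 4 + C (101 / 6) * X ^ 3 - C (265 / 12) * X ^ 2
          + C (515 / 36) * X - C (2609 / 720) ∧
      IterAsymp.P 1 IterAsymp.aRad 6 =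
        X ^ 6 - C (87 / 10) * X ^ 5 + C (95 / 3) * X ^ 4 - C 61 * X ^ 3 + C 65 * X ^ 2
          - C (12977 / 360) * X + C (29069 / 3600)) ∧
    -- Asymptotics of the iterates of the radical function, with and without abbreviation
    (∀ x₀ : ℝ, 0 < x₀ → ∃ K : ℝ,
      ((fun n : ℕ => IterAsymp.radical^[n] x₀ - IterAsymp.expansion 1 IterAsymp.aRad (-K) n)
        =O[atTop] fun n : ℕ => Real.log n ^ 7 / (n : ℝ) ^ 8) ∧
      ((fun n : ℕ => IterAsymp.radical^[n] x₀ - IterAsymp.display K (Real.log n) n)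
        =O[atTop] fun n : ℕ => Real.log n ^ 6 / (n : ℝ) ^ 7) ∧
      (∀ K' : ℝ,
        ((fun n : ℕ => IterAsymp.radical^[n] x₀ - IterAsymp.expansion 1 IterAsymp.aRad (-K') n)
          =O[atTop] fun n : ℕ => Real.log n ^ 7 / (n : ℝ) ^ 8) → K' = K)) ∧
    -- Asymptotics of the iterates of the logistic function
    (∀ x₀ : ℝ, 0 < x₀ → x₀ < 1 → ∃! K : ℝ,
      (fun n : ℕ => IterAsymp.logistic^[n] x₀ - IterAsymp.expansion 1 IterAsymp.aLog K n)
        =O[atTop] fun n : ℕ => Real.log n ^ 7 / (n : ℝ) ^ 8) ∧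
    -- Comparison of the numbers `c_i` and of the polynomials `T_m` and `P_m`
    ((∀ i ∈ Finset.Icc 1 5, 0 < IterAsymp.c 1 IterAsymp.aLog i ∧
        IterAsymp.c 1 IterAsymp.aRad i = (-1) ^ (i + 1) * IterAsymp.c 1 IterAsymp.aLog i) ∧
      (∀ m ∈ Finset.Icc 2 6, ∀ j < m,
        0 < (-1) ^ (m + 1) * (IterAsymp.T 1 IterAsymp.aRad m).coeff j ∧
        (IterAsymp.T 1 IterAsymp.aRad m).coeff j =
          (-1) ^ (m + j) * (IterAsymp.T 1 IterAsymp.aLog m).coeff j) ∧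
      (∀ m ∈ Finset.Icc 2 6, ∀ j ≤ m,
        0 < (IterAsymp.P 1 IterAsymp.aLog m).coeff j ∧
        (IterAsymp.P 1 IterAsymp.aRad m).coeff j =
          (-1) ^ (m + j) * (IterAsymp.P 1 IterAsymp.aLog m).coeff j)) ∧
    -- Comparison of the coefficients of `(log n) ^ j / n ^ (m + 1)` in the two expansions,
    -- as polynomials in the constant `K`
    (∃ Q : ℕ → ℕ → ℝ[X], ∀ m ≤ 6,
      (∀ j ≤ m, (Q m j).natDegree = m - j ∧ 0 < (Q m j).leadingCoeff) ∧
      (∀ K L : ℝ,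
        (IterAsymp.P 1 IterAsymp.aRad m).eval (-(IterAsymp.b 1 IterAsymp.aRad 1 * L - K)) =
          ∑ j ∈ Finset.range (m + 1), (Q m j).eval K * L ^ j) ∧
      (∀ K L : ℝ,
        (IterAsymp.P 1 IterAsymp.aLog m).eval (-(IterAsymp.b 1 IterAsymp.aLog 1 * L + K)) =
          ∑ j ∈ Finset.range (m + 1), ((-1) ^ m * (Q m j).eval K) * L ^ j)) := by
  refine ⟨⟨?_, IterAsymp.lam_rad, ?_, IterAsymp.aa_rad_values, ?_⟩, IterAsymp.T_rad_values,
    IterAsymp.P_rad_values, IterAsymp.radical_iterate_asymptotics,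
    IterAsymp.logistic_iterate_asymptotics, ⟨?_, IterAsymp.T_coeff_comparison,
      IterAsymp.P_coeff_comparison⟩, IterAsymp.expansion_kindred⟩
  · obtain ⟨h1, h2, h3, h4, h5, h6, h7⟩ := IterAsymp.aRad_values
    intro m
    fin_cases m <;> simp [*]
  · obtain ⟨h1, h2, h3, h4, h5, h6⟩ := IterAsymp.b_rad_values
    intro j
    fin_cases j <;> simp [*]
  · obtain ⟨h1, h2, h3, h4, h5⟩ := IterAsymp.c_rad_values
    intro i
    fin_cases i <;> simp [*]
  · obtain ⟨h1, h2, h3, h4, h5⟩ := IterAsymp.c_rad_values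
    obtain ⟨l1, l2, l3, l4, l5⟩ := IterAsymp.c_log_values
    intro i hi
    obtain ⟨hi1, hi5⟩ := Finset.mem_Icc.1 hi
    interval_cases i <;> norm_num [*]
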